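/- An MV-algebra is an algebra $\langle A,\oplus,\neg,0\rangle$ of type $(2,1,0)$ such that $\oplus$ is associative and commutative with neutral element $0$, $\neg\neg x=x$, $x\oplus\neg 0=\neg 0$, and $\neg(\neg x\oplus y)\oplus y=\neg(\neg y\oplus x)\oplus x$. Let $\mathcal{MV}_f$ be the class of finite MV-algebras with $0\neq\neg 0$; a Fraïssé limit of $\mathcal{MV}_f$ is a countable ultrahomogeneous structure in the signature $(\oplus,\neg,0)$ whose age (the class of finitely generated structures embeddable in it) is $\mathcal{MV}_f$. Let $B_\infty$ be the countable atomless Boolean algebra with $0\ne1$ (unique up to isomorphism). The Boolean center of an MV-algebra $M$ is its subalgebra $\operatorname{B}(M)=\{x\in M: x\oplus x=x\}$. Let $C\subseteq\mathbb{R}$ be the Cantor set with the usual topology and let $A$ be the subalgebra of $[0,1]^C$ (with pointwise operations $x\oplus y=\min(x+y,1)$, $\neg x=1-x$) consisting of all finite joins of functions $\overline q_U$, where $q\in[0,1]\cap\mathbb{Q}$, $U\subseteq C$ is clopen, and $\overline q_U$ is equal to $q$ on $U$ and to $0$ off $U$. Then: 1. $A$ is a Fraïssé limit of $\mathcal{MV}_f$,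 and $h\mapsto(f\mapsto f\circ h^{-1})$ is a group isomorphism from the group of self-homeomorphisms of $C$ onto $\operatorname{Aut}(A)$. 2. For every Fraïssé limit $M$ of $\mathcal{MV}_f$, $\operatorname{Aut}(M)\cong\operatorname{Aut}(B_\infty)$ as groups. Moreover, $M$ is an MV-algebra, restriction $\sigma\mapsto\sigma|_{\operatorname{B}(M)}$ is a group isomorphism $\operatorname{Aut}(M)\to\operatorname{Aut}(\operatorname{B}(M))$, and $\operatorname{B}(M)$ is isomorphic to $B_\infty$ (with $\oplus,\neg,0$ corresponding to join, complement and $0$). -/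

import Mathlib

open FirstOrder FirstOrder.Language

universe u v

/-- Function symbols of the signature `(⊕, ¬, 0)` of type `(2, 1, 0)`. -/
inductive MVFunc : ℕ → Type
  | zero : MVFunc 0
  | neg : MVFunc 1
  | oplus : MVFunc 2

/-- The first-order signature of MV-algebras; there are no relation symbols. -/
def mvLang : FirstOrder.Language.{0, 0} := ⟨MVFunc, fun _ => Empty⟩

instance : Countable (Σ n, mvLang.Functions n) := by
  refine Function.Injective.countable (β := ℕ) (f := fun s => s.1) ?_
  rintro ⟨m, f⟩ ⟨n, g⟩ h
  obtain rfl : m = n := h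
  change MVFunc m at f g
  cases f <;> cases g <;> rfl

/-- The `mvLang`-structure given by a constant, a unary and a binary operation. -/
@[reducible] def mvStructure {M : Type u} (z : M) (neg : M → M) (add : M → M → M) :
    mvLang.Structure M where
  funMap := fun {n} f =>
    match n, (f : MVFunc n) with
    | _, .zero => fun _ => z
    | _, .neg => fun x => neg (x 0)
    | _, .oplus => fun x => add (x 0) (x 1)
  RelMap := fun r => Empty.elim r

section Operations

variable {M : Type u} [mvLang.Structure M]

variable (M) in
/-- The constant `0`. -/
def mvZero : M := Structure.funMap (L := mvLang) MVFunc.zero ![]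

/-- The negation `¬ x`. -/
def mvNeg (x : M) : M := Structure.funMap (L := mvLang) MVFunc.neg ![x]

/-- The Łukasiewicz sum `x ⊕ y`. -/
def mvAdd (x y : M) : M := Structure.funMap (L := mvLang) MVFunc.oplus ![x, y]

end Operations

/-- The equations defining MV-algebras. -/
structure IsMVAlgebra (M : Type u) [mvLang.Structure M] : Prop where
  add_assoc : ∀ x y z : M, mvAdd x (mvAdd y z) = mvAdd (mvAdd x y) z
  add_comm : ∀ x y : M, mvAdd x y = mvAdd y x
  add_zero : ∀ x : M, mvAdd x (mvZero M) = x
  neg_neg : ∀ x : M, mvNeg (mvNeg x) = x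
  add_neg_zero : ∀ x : M, mvAdd x (mvNeg (mvZero M)) = mvNeg (mvZero M)
  lukasiewicz : ∀ x y : M,
    mvAdd (mvNeg (mvAdd (mvNeg x) y)) y = mvAdd (mvNeg (mvAdd (mvNeg y) x)) x

/-- The class of finite (nontrivial, that is, `0 ≠ 1`) MV-algebras. -/
def finiteMV : Set (CategoryTheory.Bundled.{u} mvLang.Structure) :=
  {S | IsMVAlgebra S ∧ Finite S ∧ Nontrivial S}

/-- The automorphism group of a first-order structure, under composition. -/
instance autGroup (L : FirstOrder.Language.{0, 0}) (M : Type u) [L.Structure M] : Group (M ≃[L] M) where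
  mul f g := f.comp g
  one := FirstOrder.Language.Equiv.refl L M
  inv f := f.symm
  mul_assoc _ _ _ := rfl
  one_mul _ := rfl
  mul_one _ := rfl
  inv_mul_cancel f := by
    apply FirstOrder.Language.Equiv.ext
    intro x
    exact f.symm_apply_apply x

/-! ### The Boolean center -/

theorem IsMVAlgebra.neg_idem {M : Type u} [mvLang.Structure M] (hM : IsMVAlgebra M) {x : M}
    (hx : mvAdd x x = x) : mvAdd (mvNeg x) (mvNeg x) = mvNeg x := by
  have em : ∀ a : M, mvAdd (mvNeg a) a = mvNeg (mvZero M) := by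
    intro a
    have h := hM.lukasiewicz a (mvNeg (mvZero M))
    rw [hM.add_neg_zero, hM.neg_neg, hM.add_comm (mvZero M) a, hM.add_zero] at h
    exact h.symm
  have anti : ∀ a b : M, mvAdd (mvNeg a) b = mvNeg (mvZero M) →
      mvAdd (mvNeg b) a = mvNeg (mvZero M) → a = b := by
    intro a b h1 h2
    have h := hM.lukasiewicz a b
    rw [h1, h2, hM.neg_neg, hM.add_comm _ b, hM.add_comm _ a, hM.add_zero, hM.add_zero] at h
    exact h.symm
  apply anti
  · have h := hM.lukasiewicz x (mvNeg x)
    rw [hM.neg_neg, hx, em] at h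
    exact h
  · rw [hM.neg_neg, hM.add_assoc, hM.add_comm x, em, hM.add_comm, hM.add_neg_zero]

/-- The Boolean center of an MV-algebra: the subalgebra of its idempotent elements. -/
def booleanCenter {M : Type u} [mvLang.Structure M] (hM : IsMVAlgebra M) :
    mvLang.Substructure M where
  carrier := {x | mvAdd x x = x}
  fun_mem := by
    intro n f xs hxs
    change MVFunc n at f
    cases f with
    | zero =>
      have h : (Structure.funMap (L := mvLang) MVFunc.zero xs : M) = mvZero M :=
        congrArg _ (Subsingleton.elim _ _)
      change mvAdd (Structure.funMap (L := mvLang) MVFunc.zero xs : M) _ = _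
      rw [h]
      exact hM.add_zero _
    | neg =>
      have h : (Structure.funMap (L := mvLang) MVFunc.neg xs : M) = mvNeg (xs 0) :=
        congrArg _ (by ext i; fin_cases i; rfl)
      change mvAdd (Structure.funMap (L := mvLang) MVFunc.neg xs : M) _ = _
      rw [h]
      exact hM.neg_idem (hxs 0)
    | oplus =>
      have h : (Structure.funMap (L := mvLang) MVFunc.oplus xs : M) = mvAdd (xs 0) (xs 1) :=
        congrArg _ (by ext i; fin_cases i <;> rfl)
      change mvAdd (Structure.funMap (L := mvLang) MVFunc.oplus xs : M) _ = _
      rw [h]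
      have h0 : mvAdd (xs 0) (xs 0) = xs 0 := hxs 0
      have h1 : mvAdd (xs 1) (xs 1) = xs 1 := hxs 1
      calc mvAdd (mvAdd (xs 0) (xs 1)) (mvAdd (xs 0) (xs 1))
          = mvAdd (mvAdd (xs 0) (xs 0)) (mvAdd (xs 1) (xs 1)) := by
            rw [← hM.add_assoc, hM.add_assoc (xs 1), hM.add_comm (xs 1) (xs 0),
              ← hM.add_assoc (xs 0) (xs 1), hM.add_assoc]
        _ = _ := by rw [h0, h1]

/-! ### Rational-valued fuzzy clopens of the Cantor set -/

/-- The MV-algebra `[0,1]^X` of fuzzy subsets of `X`: pointwise `min (x + y) 1` and `1 - x`. -/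
instance fuzzyStructure (X : Type u) : mvLang.Structure (X → unitInterval) :=
  mvStructure (fun _ => 0) (fun f x => unitInterval.symm (f x))
    (fun f g x => ⟨min ((f x : ℝ) + g x) 1,
      le_min (add_nonneg (f x).2.1 (g x).2.1) zero_le_one, min_le_right _ _⟩)

/-- The fuzzy set with value `q` on `U` and `0` outside `U`. -/
noncomputable def fuzzyConst (q : unitInterval) (U : Set cantorSet) : cantorSet → unitInterval :=
  U.indicator fun _ => q

/-- Finite joins of fuzzy sets `fuzzyConst q U` with `q` rational and `U` a clopen subset of the
Cantor set. -/
def rationalFuzzyClopens : Set (cantorSet → unitInterval) :=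
  {f | ∃ (n : ℕ) (q : Fin n → unitInterval) (U : Fin n → Set cantorSet),
    (∀ i, ∃ r : ℚ, (q i : ℝ) = r) ∧ (∀ i, IsClopen (U i)) ∧
    f = Finset.univ.sup fun i => fuzzyConst (q i) (U i)}

theorem mem_rationalFuzzyClopens_iff (f : cantorSet → unitInterval) :
    f ∈ rationalFuzzyClopens ↔ IsLocallyConstant f ∧ ∀ x, ∃ r : ℚ, (f x : ℝ) = r := by
  constructor
  · rintro ⟨n, q, U, hq, hU, rfl⟩
    refine Finset.sup_induction (p := fun f : cantorSet → unitInterval =>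
      IsLocallyConstant f ∧ ∀ x, ∃ r : ℚ, (f x : ℝ) = r) ?_ ?_ ?_
    · exact ⟨IsLocallyConstant.const _, fun x => ⟨0, by simp⟩⟩
    · rintro f ⟨hf, hf'⟩ g ⟨hg, hg'⟩
      refine ⟨hf.comp₂ hg (· ⊔ ·), fun x => ?_⟩
      rcases le_total (f x) (g x) with h | h
      · simpa [h] using hg' x
      · simpa [h] using hf' x
    · intro i _
      constructor
      · rw [IsLocallyConstant.iff_exists_open]
        intro x
        by_cases hx : x ∈ U i
        · exact ⟨U i, (hU i).isOpen, hx, fun y hy => by simp [fuzzyConst, hx, hy]⟩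
        · exact ⟨(U i)ᶜ, (hU i).compl.isOpen, hx, fun y hy => by
            have : y ∉ U i := hy
            simp [fuzzyConst, hx, this]⟩
      · intro x
        by_cases hx : x ∈ U i
        · simpa [fuzzyConst, hx] using hq i
        · exact ⟨0, by simp [fuzzyConst, hx]⟩
  · rintro ⟨hf, hq⟩
    have : CompactSpace cantorSet := isCompact_iff_compactSpace.mp isCompact_cantorSet
    have hfin : (Set.range f).Finite := hf.range_finite
    let _ := hfin.fintype
    let e := Fintype.equivFin (Set.range f)
    refine ⟨_, fun i => (e.symm i : unitInterval), fun i => f ⁻¹' {(e.symm i : unitInterval)},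
      fun i => ?_, fun i => hf.isClopen_fiber _, ?_⟩
    · obtain ⟨x, hx⟩ := (e.symm i).2
      obtain ⟨r, hr⟩ := hq x
      exact ⟨r, by rw [← hr, hx]⟩
    · funext x
      apply le_antisymm
      · rw [Finset.sup_apply]
        refine le_trans ?_ (Finset.le_sup (Finset.mem_univ (e ⟨f x, x, rfl⟩)))
        simp [fuzzyConst]
      · rw [Finset.sup_apply]
        refine Finset.sup_le fun i _ => ?_
        by_cases h : f x = (e.symm i : unitInterval)
        · simp [fuzzyConst, h]
        · simp [fuzzyConst, h]

/-- The MV-algebra `A` of rational-valued fuzzy clopens of the Cantor set, as a subalgebra of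
`[0,1]^C`. -/
def cantorMV : mvLang.Substructure (cantorSet → unitInterval) where
  carrier := rationalFuzzyClopens
  fun_mem := by
    intro n f xs hxs
    change MVFunc n at f
    simp only [mem_rationalFuzzyClopens_iff] at hxs ⊢
    cases f with
    | zero => exact ⟨IsLocallyConstant.const _, fun x => ⟨0, by simp [Structure.funMap]⟩⟩
    | neg =>
      refine ⟨(hxs 0).1.comp unitInterval.symm, fun x => ?_⟩
      obtain ⟨r, hr⟩ := (hxs 0).2 x
      exact ⟨1 - r, by simp [Structure.funMap, hr]⟩
    | oplus =>
      refine ⟨(hxs 0).1.comp₂ (hxs 1).1 (fun a b : unitInterval =>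
        (⟨min ((a : ℝ) + b) 1, le_min (add_nonneg a.2.1 b.2.1) zero_le_one,
          min_le_right _ _⟩ : unitInterval)), fun x => ?_⟩
      obtain ⟨r, hr⟩ := (hxs 0).2 x
      obtain ⟨s, hs⟩ := (hxs 1).2 x
      exact ⟨min (r + s) 1, by simp [Structure.funMap, hr, hs]⟩

instance : Countable cantorMV := by
  have : CompactSpace cantorSet := isCompact_iff_compactSpace.mp isCompact_cantorSet
  have : Countable (TopologicalSpace.Clopens cantorSet) :=
    have : TotallyDisconnectedSpace cantorSet :=
      cantorSetHomeomorphNatToBool.symm.totallyDisconnectedSpace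
    TopologicalSpace.Clopens.countable_iff_secondCountable.mpr inferInstance
  let Q := {q : unitInterval // ∃ r : ℚ, (q : ℝ) = r}
  have : Countable Q := by
    choose r hr using fun q : Q => q.2
    refine Function.Injective.countable (f := r) fun a b h => ?_
    exact Subtype.ext (Subtype.ext ((hr a).trans (h ▸ (hr b).symm)))
  have h : rationalFuzzyClopens ⊆ Set.range
      (fun p : Σ n, (Fin n → Q) × (Fin n → TopologicalSpace.Clopens cantorSet) =>
        Finset.univ.sup fun i => fuzzyConst (p.2.1 i).1 (p.2.2 i)) := by
    rintro f ⟨n, q, U, hq, hU, rfl⟩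
    exact ⟨⟨n, fun i => ⟨q i, hq i⟩, fun i => ⟨U i, hU i⟩⟩, rfl⟩
  exact ((Set.countable_range _).mono h).to_subtype

/-! Everything is derived from one kind of representation: `IsLocConstRep V ι` identifies an algebra
with all locally constant maps from a space `X` to a set `V ⊆ [0,1]`. On a perfect Stone space, `V`
the rationals gives `A` and its Fraïssé relatives, while `V = {0,1}` gives atomless Boolean
algebras; the arguments run for both at once.

Points are recovered from the algebra: on a compact space, every character (homomorphism to `[0,1]`)
of an algebra of locally constant functions is an evaluation (`exists_eq_eval`). Finite MV-algebras
enter through characters too: an atom `a` yields `y ↦ coeff a y / order a`, and these rational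
characters separate elements (`exists_chars`), so no decomposition into chains is needed.

Finitely generated subalgebras are finite, because denominators and fibres are bounded
(`IsLocConstRep.finite_of_fg`). To extend an embedding from `S₀` to a larger finite `S₁`, a locally
constant map onto the points of `S₀` must be lifted to one onto the points of `S₁`. Its fibres are
nonempty and open in a perfect space, so they split into as many pieces as required
(`IsLocConstRep.isExtensionPair`). Back-and-forth then gives ultrahomogeneity and uniqueness.

Finally, automorphisms are homeomorphisms of `X` (`IsLocConstRep.homeomorphMulEquiv`). The Boolean
center is the algebra of `{0,1}`-valued functions on the same `X`, so it has the same automorphism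
group, and Stone duality with uniqueness for `V = {0,1}` identifies it with `B_∞`. -/

/-- MV-algebras in algebraic notation: `x + y` is the Łukasiewicz sum and `xᶜ` the negation. -/
class MVAlgebra (M : Type u) extends AddCommMonoid M, Compl M where
  protected compl_compl : ∀ x : M, xᶜᶜ = x
  add_compl_zero : ∀ x : M, x + 0ᶜ = 0ᶜ
  lukasiewicz : ∀ x y : M, (xᶜ + y)ᶜ + y = (yᶜ + x)ᶜ + x

/-! ### Order and truncated difference in an MV-algebra. -/

namespace MVAlgebra

variable {M : Type u} [MVAlgebra M]

theorem compl_add_self (x : M) : xᶜ + x = 0ᶜ := by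
  have h := lukasiewicz x (0ᶜ : M)
  rw [add_compl_zero, MVAlgebra.compl_compl, zero_add] at h
  exact h.symm

theorem compl_injective {x y : M} (h : xᶜ = yᶜ) : x = y := by
  rw [← MVAlgebra.compl_compl x, h, MVAlgebra.compl_compl]

theorem exists_add_iff {x y : M} : (∃ z, x + z = y) ↔ xᶜ + y = 0ᶜ := by
  constructor
  · rintro ⟨z, rfl⟩
    rw [← add_assoc, compl_add_self, add_comm, add_compl_zero]
  · intro h
    refine ⟨(yᶜ + x)ᶜ, ?_⟩
    rw [add_comm, ← lukasiewicz, h, MVAlgebra.compl_compl, zero_add]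

instance : PartialOrder M where
  le x y := xᶜ + y = 0ᶜ
  le_refl := compl_add_self
  le_trans x y z h1 h2 := by
    obtain ⟨a, rfl⟩ := exists_add_iff.2 h1
    obtain ⟨b, rfl⟩ := exists_add_iff.2 h2
    exact exists_add_iff.1 ⟨a + b, (add_assoc _ _ _).symm⟩
  le_antisymm x y h1 h2 := by
    have h := lukasiewicz x y
    rw [h1, h2, MVAlgebra.compl_compl, zero_add, zero_add] at h
    exact h.symm

theorem le_def {x y : M} : x ≤ y ↔ xᶜ + y = 0ᶜ := Iff.rfl

theorem le_iff_exists_add' {x y : M} : x ≤ y ↔ ∃ z, x + z = y := exists_add_iff.symm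

protected theorem zero_le (x : M) : 0 ≤ x := le_iff_exists_add'.2 ⟨x, zero_add x⟩

theorem le_compl_zero (x : M) : x ≤ 0ᶜ := add_compl_zero _

theorem le_zero_iff {x : M} : x ≤ 0 ↔ x = 0 :=
  ⟨fun h => le_antisymm h (MVAlgebra.zero_le x), fun h => h.le⟩

theorem le_add_right' (x y : M) : x ≤ x + y := le_iff_exists_add'.2 ⟨y, rfl⟩

theorem add_le_add_right' {x y : M} (h : x ≤ y) (z : M) : x + z ≤ y + z := by
  obtain ⟨w, rfl⟩ := le_iff_exists_add'.1 h
  exact le_iff_exists_add'.2 ⟨w, by abel⟩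

theorem compl_le_compl_iff' {x y : M} : xᶜ ≤ yᶜ ↔ y ≤ x := by
  rw [le_def, le_def, MVAlgebra.compl_compl, add_comm]

/-- Truncated difference. -/
def diff (x y : M) : M := (xᶜ + y)ᶜ

theorem diff_le_iff {x y z : M} : diff x y ≤ z ↔ x ≤ z + y := by
  rw [le_def, le_def, diff, MVAlgebra.compl_compl, add_assoc, add_comm y]

theorem diff_le (x y : M) : diff x y ≤ x := diff_le_iff.2 (le_add_right' x y)

theorem le_diff_add (x y : M) : x ≤ diff x y + y := diff_le_iff.1 le_rfl

theorem diff_add_cancel {x y : M} (h : y ≤ x) : diff x y + y = x := by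
  rw [diff, lukasiewicz, le_def.1 h, MVAlgebra.compl_compl, zero_add]

theorem diff_le_diff {x y : M} (h : x ≤ y) (z : M) : diff x z ≤ diff y z :=
  diff_le_iff.2 (h.trans (le_diff_add y z))

theorem diff_eq_zero_iff {x y : M} : diff x y = 0 ↔ x ≤ y := by
  rw [← le_zero_iff, diff_le_iff, zero_add]

theorem diff_compl (x y : M) : diff xᶜ y = (x + y)ᶜ := by
  rw [diff, MVAlgebra.compl_compl]

/-- Cancellation: `a ≤ xᶜ` says that `a + x` is not truncated, so `x` can be subtracted again. -/
theorem add_diff_of_le_compl {a x : M} (h : a ≤ xᶜ) : diff (a + x) x = a := by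
  apply compl_injective
  rw [diff, MVAlgebra.compl_compl]
  have h2 := lukasiewicz aᶜ x
  rw [MVAlgebra.compl_compl] at h2
  rw [h2, add_comm xᶜ, le_def.1 h, MVAlgebra.compl_compl, zero_add]

/-! ### Atoms and multiplicities. -/

section Atom

/-- Minimal nonzero elements. -/
def IsMVAtom (a : M) : Prop := a ≠ 0 ∧ ∀ z ≤ a, z = 0 ∨ z = a

theorem exists_isMVAtom_le [Finite M] {x : M} (hx : x ≠ 0) : ∃ a, IsMVAtom a ∧ a ≤ x := by
  obtain ⟨a, hax, ha⟩ := (Set.toFinite {y : M | y ≠ 0}).exists_le_minimal hx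
  refine ⟨a, ⟨ha.prop, fun z hz => ?_⟩, hax⟩
  by_cases h : z = 0
  · exact Or.inl h
  · exact Or.inr (le_antisymm hz (ha.le_of_le h hz))

variable {a : M} (ha : IsMVAtom a)
include ha

/-- Atoms are prime for the sum: `diff a s ≤ a` is either `0` or `a`, which puts `a` below `s` or
below `r`. -/
theorem IsMVAtom.not_le_add {r s : M} (hr : ¬ a ≤ r) (hs : ¬ a ≤ s) : ¬ a ≤ r + s := by
  intro h
  rcases ha.2 _ (diff_le a s) with h0 | h0
  · exact hs (diff_eq_zero_iff.1 h0)
  · exact hr (h0 ▸ diff_le_iff.2 h)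

theorem IsMVAtom.add_diff {x : M} (h : a + x ≠ x) : diff (a + x) x = a := by
  rcases ha.2 _ (diff_le_iff.2 le_rfl : diff (a + x) x ≤ a) with h0 | h0
  · exact absurd (le_antisymm (diff_eq_zero_iff.1 h0) (add_comm a x ▸ le_add_right' x a)) h
  · exact h0

theorem IsMVAtom.not_le_compl {x : M} (h : a + x = x) : ¬ a ≤ xᶜ := by
  intro h1
  have h2 := add_diff_of_le_compl h1
  rw [h] at h2
  exact ha.1 (h2.symm.trans (diff_eq_zero_iff.2 le_rfl))

end Atom

theorem nsmul_le_nsmul_left' (a : M) {k l : ℕ} (h : k ≤ l) : k • a ≤ l • a := by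
  obtain ⟨d, rfl⟩ := Nat.exists_eq_add_of_le h
  rw [add_nsmul]
  exact le_add_right' _ _

theorem exists_nsmul_stable [Finite M] (a : M) : ∃ n : ℕ, a + n • a = n • a := by
  by_contra! h
  refine not_injective_infinite_finite (fun n : ℕ => n • a)
    (strictMono_nat_of_lt_succ fun n => ?_).injective
  refine lt_of_le_of_ne (nsmul_le_nsmul_left' a n.le_succ) fun h1 => h n ?_
  rw [← succ_nsmul']
  exact h1.symm

open Classical in
/-- The least `n` with `(n + 1) • a = n • a`. -/
noncomputable def order [Finite M] (a : M) : ℕ := Nat.find (exists_nsmul_stable a)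

open Classical in
/-- The largest `k ≤ order a` with `k • a ≤ y`. -/
noncomputable def coeff [Finite M] (a y : M) : ℕ := Nat.findGreatest (fun k => k • a ≤ y) (order a)

variable [Finite M]

theorem add_order_nsmul (a : M) : a + order a • a = order a • a := by
  classical
  exact Nat.find_spec (exists_nsmul_stable a)

theorem add_nsmul_ne {a : M} {k : ℕ} (h : k < order a) : a + k • a ≠ k • a := by
  classical
  exact Nat.find_min (exists_nsmul_stable a) h

theorem nsmul_of_order_le (a : M) {k : ℕ} (h : order a ≤ k) : k • a = order a • a := by
  induction k, h using Nat.le_induction with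
  | base => rfl
  | succ k _ ih => rw [succ_nsmul', ih, add_order_nsmul]

theorem coeff_le_order (a y : M) : coeff a y ≤ order a := by
  classical
  exact Nat.findGreatest_le _

theorem coeff_nsmul_le (a y : M) : coeff a y • a ≤ y := by
  classical
  exact Nat.findGreatest_spec (P := fun k => k • a ≤ y) (Nat.zero_le _)
    (by rw [zero_nsmul]; exact MVAlgebra.zero_le y)

theorem le_coeff {a y : M} {k : ℕ} (hk : k ≤ order a) (h : k • a ≤ y) : k ≤ coeff a y := by
  classical
  exact Nat.le_findGreatest hk h

variable {a : M} (ha : IsMVAtom a)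
include ha

theorem IsMVAtom.order_pos : 0 < order a := by
  rw [pos_iff_ne_zero]
  intro h
  have := add_order_nsmul a
  rw [h, zero_nsmul, add_zero] at this
  exact ha.1 this

theorem IsMVAtom.nsmul_succ_diff {k : ℕ} (h : k < order a) : diff ((k + 1) • a) (k • a) = a := by
  rw [succ_nsmul']
  exact ha.add_diff (add_nsmul_ne h)

theorem IsMVAtom.exists_eq_coeff_nsmul_add (y : M) : ∃ r, ¬ a ≤ r ∧ y = coeff a y • a + r := by
  refine ⟨diff y (coeff a y • a), fun h => ?_, ?_⟩
  -- Below the order, a remainder above `a` would raise the coefficient. At the order, the remainder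
  -- lies below `(order a • a)ᶜ`, and `a` does not, since it is absorbed by `order a • a`.
  · rcases (coeff_le_order a y).lt_or_eq with hlt | heq
    · have h1 := add_le_add_right' h (coeff a y • a)
      rw [diff_add_cancel (coeff_nsmul_le a y), ← succ_nsmul'] at h1
      have := le_coeff hlt h1
      omega
    · rw [heq] at h
      refine ha.not_le_compl (add_order_nsmul a)
        (h.trans ((diff_le_diff (le_compl_zero y) _).trans ?_))
      rw [diff_compl, zero_add]
  · rw [add_comm, diff_add_cancel (coeff_nsmul_le a y)]

theorem IsMVAtom.le_of_nsmul_le {k l : ℕ} {r : M} (hr : ¬ a ≤ r) (hl : l ≤ order a)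
    (h : l • a ≤ k • a + r) : l ≤ k := by
  by_contra! hlt
  have h1 : (k + 1) • a ≤ k • a + r := (nsmul_le_nsmul_left' a hlt).trans h
  rw [add_comm (k • a)] at h1
  have h2 := diff_le_iff.2 h1
  rw [ha.nsmul_succ_diff (by omega)] at h2
  exact hr h2

theorem IsMVAtom.coeff_eq {k : ℕ} {r : M} (hr : ¬ a ≤ r) :
    coeff a (k • a + r) = min k (order a) := by
  apply le_antisymm
  · exact le_min (ha.le_of_nsmul_le hr (coeff_le_order _ _) (coeff_nsmul_le _ _)) (coeff_le_order _ _)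
  · exact le_coeff (min_le_right _ _)
      ((nsmul_le_nsmul_left' a (min_le_left _ _)).trans (le_add_right' _ _))

theorem IsMVAtom.coeff_zero : coeff a 0 = 0 := by
  have h := ha.coeff_eq (k := 0) (r := 0) (by rw [le_zero_iff]; exact ha.1)
  simpa using h

/-- Split off the multiples of `a`; by primality the sum of the two remainders is still not above
`a`. -/
theorem IsMVAtom.coeff_add (y z : M) : coeff a (y + z) = min (coeff a y + coeff a z) (order a) := by
  obtain ⟨r, hr, hy⟩ := ha.exists_eq_coeff_nsmul_add y
  obtain ⟨s, hs, hz⟩ := ha.exists_eq_coeff_nsmul_add z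
  rw [← ha.coeff_eq (ha.not_le_add hr hs), add_nsmul]
  congr 1
  conv_lhs => rw [hy, hz]
  abel

theorem IsMVAtom.coeff_compl (y : M) : coeff a yᶜ + coeff a y = order a := by
  apply le_antisymm
  · by_contra! hlt
    -- Subtracting `j • a` from `(j + 1) • a ≤ y ≤ (coeff a yᶜ • a)ᶜ` leaves `a` below the
    -- complement of a multiple with index at least `order a`.
    obtain ⟨j, hj⟩ : ∃ j, coeff a y = j + 1 :=
      Nat.exists_eq_succ_of_ne_zero (by have := coeff_le_order a yᶜ; omega)
    have hy := coeff_nsmul_le a y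
    have hz := coeff_nsmul_le a yᶜ
    rw [hj] at hy
    rw [← MVAlgebra.compl_compl (_ • a), compl_le_compl_iff'] at hz
    have h1 := (diff_le_diff hy (j • a)).trans (diff_le_diff hz (j • a))
    rw [ha.nsmul_succ_diff (by have := coeff_le_order a y; omega), diff_compl, ← add_nsmul,
      nsmul_of_order_le a (by omega)] at h1
    exact ha.not_le_compl (add_order_nsmul a) h1
  · have h1 := ha.coeff_add yᶜ y
    have h2 : order a ≤ coeff a (0ᶜ : M) := le_coeff le_rfl (le_compl_zero _)
    rw [compl_add_self] at h1
    omega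

theorem IsMVAtom.coeff_pos {y : M} (h : a ≤ y) : 0 < coeff a y :=
  le_coeff ha.order_pos (by rwa [one_nsmul])

end MVAlgebra

/-! ### Homomorphisms in the signature `(⊕, ¬, 0)`. -/

section Homomorphisms

variable {M N : Type*} [mvLang.Structure M] [mvLang.Structure N]

theorem funMap_zero (x : Fin 0 → M) :
    Structure.funMap (L := mvLang) MVFunc.zero x = mvZero M :=
  congrArg _ (Subsingleton.elim _ _)

theorem funMap_neg (x : Fin 1 → M) :
    Structure.funMap (L := mvLang) MVFunc.neg x = mvNeg (x 0) :=
  congrArg _ (by ext i; fin_cases i; rfl)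

theorem funMap_oplus (x : Fin 2 → M) :
    Structure.funMap (L := mvLang) MVFunc.oplus x = mvAdd (x 0) (x 1) :=
  congrArg _ (by ext i; fin_cases i <;> rfl)

theorem map_funMap_of_mv {f : M → N} (h0 : f (mvZero M) = mvZero N)
    (hn : ∀ x, f (mvNeg x) = mvNeg (f x)) (ha : ∀ x y, f (mvAdd x y) = mvAdd (f x) (f y))
    {n : ℕ} (g : mvLang.Functions n) (x : Fin n → M) :
    f (Structure.funMap g x) = Structure.funMap g (f ∘ x) := by
  change MVFunc n at g
  cases g with
  | zero => exact (congrArg f (funMap_zero x)).trans (h0.trans (funMap_zero _).symm)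
  | neg => exact (congrArg f (funMap_neg x)).trans ((hn _).trans (funMap_neg (f ∘ x)).symm)
  | oplus => exact (congrArg f (funMap_oplus x)).trans ((ha _ _).trans (funMap_oplus (f ∘ x)).symm)

/-- An injective map preserving the MV-operations is an embedding. -/
def mvEmbedding (f : M → N) (hf : Function.Injective f) (h0 : f (mvZero M) = mvZero N)
    (hn : ∀ x, f (mvNeg x) = mvNeg (f x)) (ha : ∀ x y, f (mvAdd x y) = mvAdd (f x) (f y)) :
    M ↪[mvLang] N where
  toFun := f
  inj' := hf
  map_fun' := map_funMap_of_mv h0 hn ha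
  map_rel' := fun r => Empty.elim r

/-- A bijection preserving the MV-operations is an isomorphism. -/
def mvEquiv (f : M ≃ N) (h0 : f (mvZero M) = mvZero N)
    (hn : ∀ x, f (mvNeg x) = mvNeg (f x)) (ha : ∀ x y, f (mvAdd x y) = mvAdd (f x) (f y)) :
    M ≃[mvLang] N where
  toEquiv := f
  map_fun' := map_funMap_of_mv h0 hn ha
  map_rel' := fun r => Empty.elim r

/-- A subset closed under the MV-operations is a subalgebra. -/
def mvSubstructure (P : Set M) (h0 : mvZero M ∈ P) (hn : ∀ x ∈ P, mvNeg x ∈ P)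
    (ha : ∀ x ∈ P, ∀ y ∈ P, mvAdd x y ∈ P) : mvLang.Substructure M where
  carrier := P
  fun_mem := by
    intro n g x hx
    change MVFunc n at g
    cases g with
    | zero => exact (funMap_zero x).symm ▸ h0
    | neg => exact (funMap_neg x).symm ▸ hn _ (hx 0)
    | oplus => exact (funMap_oplus x).symm ▸ ha _ (hx 0) _ (hx 1)

variable {F : Type*} [FunLike F M N] [mvLang.HomClass F M N]

theorem map_mvZero (f : F) : f (mvZero M) = mvZero N :=
  (HomClass.map_fun f _ _).trans (funMap_zero _)

theorem map_mvNeg (f : F) (x : M) : f (mvNeg x) = mvNeg (f x) :=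
  (HomClass.map_fun f _ _).trans (funMap_neg _)

theorem map_mvAdd (f : F) (x y : M) : f (mvAdd x y) = mvAdd (f x) (f y) :=
  (HomClass.map_fun f _ _).trans (funMap_oplus _)

theorem IsMVAlgebra.of_injective (f : F) (hf : Function.Injective f) (hN : IsMVAlgebra N) :
    IsMVAlgebra M where
  add_assoc x y z := hf (by simp only [map_mvAdd, hN.add_assoc])
  add_comm x y := hf (by simp only [map_mvAdd]; exact hN.add_comm _ _)
  add_zero x := hf (by simp only [map_mvAdd, map_mvZero, hN.add_zero])
  neg_neg x := hf (by simp only [map_mvNeg, hN.neg_neg])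
  add_neg_zero x := hf (by simp only [map_mvAdd, map_mvNeg, map_mvZero, hN.add_neg_zero])
  lukasiewicz x y := hf (by
    simp only [map_mvAdd, map_mvNeg]
    exact hN.lukasiewicz _ _)

end Homomorphisms

/-- The algebraic notation attached to an MV-algebra. -/
@[reducible] def IsMVAlgebra.toMVAlgebra {M : Type u} [mvLang.Structure M] (hM : IsMVAlgebra M) :
    MVAlgebra M where
  zero := mvZero M
  add := mvAdd
  compl := mvNeg
  add_assoc x y z := (hM.add_assoc x y z).symm
  add_comm := hM.add_comm
  add_zero := hM.add_zero
  zero_add x := (hM.add_comm _ _).trans (hM.add_zero x)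
  nsmul := @nsmulRec M ⟨mvZero M⟩ ⟨mvAdd⟩
  compl_compl := hM.neg_neg
  add_compl_zero := hM.add_neg_zero
  lukasiewicz := hM.lukasiewicz

/-! ### The MV-algebra `[0,1]^X`. -/

section Fuzzy

variable {X : Type u}

theorem fuzzy_mvZero (x : X) : ((mvZero (X → unitInterval) x : unitInterval) : ℝ) = 0 := rfl

theorem fuzzy_mvNeg (f : X → unitInterval) (x : X) : ((mvNeg f x : unitInterval) : ℝ) = 1 - f x :=
  rfl

theorem fuzzy_mvAdd (f g : X → unitInterval) (x : X) :
    ((mvAdd f g x : unitInterval) : ℝ) = min ((f x : ℝ) + g x) 1 := rfl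

theorem fuzzy_ext {f g : X → unitInterval} (h : ∀ x, (f x : ℝ) = g x) : f = g :=
  funext fun x => Subtype.ext (h x)

theorem fuzzy_isMVAlgebra (X : Type u) : IsMVAlgebra (X → unitInterval) where
  add_assoc f g h := fuzzy_ext fun x => by
    simp only [fuzzy_mvAdd]
    have := (f x).2.1; have := (h x).2.1
    rcases le_total ((g x : ℝ) + h x) 1 with h1 | h1 <;>
    rcases le_total ((f x : ℝ) + g x) 1 with h2 | h2 <;> simp only [h1, h2, min_eq_left, min_eq_right]
    · rw [add_assoc]
    · rw [min_eq_right, min_eq_right] <;> linarith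
    · rw [min_eq_right, min_eq_right] <;> linarith
    · rw [min_eq_right, min_eq_right] <;> linarith
  add_comm f g := fuzzy_ext fun x => by simp only [fuzzy_mvAdd, add_comm]
  add_zero f := fuzzy_ext fun x => by
    simp only [fuzzy_mvAdd, fuzzy_mvZero, add_zero, min_eq_left (f x).2.2]
  neg_neg f := fuzzy_ext fun x => by simp only [fuzzy_mvNeg, sub_sub_cancel]
  add_neg_zero f := fuzzy_ext fun x => by
    simp only [fuzzy_mvAdd, fuzzy_mvNeg, fuzzy_mvZero, sub_zero]
    exact min_eq_right (by linarith [(f x).2.1])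
  lukasiewicz f g := fuzzy_ext fun x => by
    simp only [fuzzy_mvAdd, fuzzy_mvNeg]
    have := (f x).2.2; have := (g x).2.2
    rcases le_total ((f x : ℝ)) (g x) with h | h
    · rw [min_eq_right (by linarith : (1 : ℝ) ≤ 1 - f x + g x),
        min_eq_left (by linarith : 1 - (g x : ℝ) + f x ≤ 1)]
      ring_nf
    · rw [min_eq_right (by linarith : (1 : ℝ) ≤ 1 - g x + f x),
        min_eq_left (by linarith : 1 - (f x : ℝ) + g x ≤ 1)]
      ring_nf

end Fuzzy

/-! ### Characters, and why they are evaluations. -/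

/-- Homomorphisms to the standard MV-algebra `[0,1]`, as real-valued maps. -/
structure IsMVChar {S : Type*} [mvLang.Structure S] (φ : S → ℝ) : Prop where
  nonneg : ∀ s, 0 ≤ φ s
  le_one : ∀ s, φ s ≤ 1
  map_zero : φ (mvZero S) = 0
  map_neg : ∀ s, φ (mvNeg s) = 1 - φ s
  map_add : ∀ s t, φ (mvAdd s t) = min (φ s + φ t) 1

section Characters

variable {S T : Type*} [mvLang.Structure S] [mvLang.Structure T] {X : Type*}

theorem IsMVChar.comp {F : Type*} [FunLike F S T] [mvLang.HomClass F S T] {φ : T → ℝ}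
    (hφ : IsMVChar φ) (f : F) : IsMVChar fun s => φ (f s) where
  nonneg _ := hφ.nonneg _
  le_one _ := hφ.le_one _
  map_zero := by rw [map_mvZero, hφ.map_zero]
  map_neg _ := by rw [map_mvNeg, hφ.map_neg]
  map_add _ _ := by rw [map_mvAdd, hφ.map_add]

theorem isMVChar_eval (x : X) : IsMVChar fun f : X → unitInterval => (f x : ℝ) where
  nonneg f := (f x).2.1
  le_one f := (f x).2.2
  map_zero := fuzzy_mvZero x
  map_neg f := fuzzy_mvNeg f x
  map_add f g := fuzzy_mvAdd f g x

/-- A point-separating family of characters gives an embedding into a fuzzy power. -/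
def embeddingOfChars (φ : X → S → ℝ) (hφ : ∀ x, IsMVChar (φ x))
    (hinj : ∀ s t, (∀ x, φ x s = φ x t) → s = t) : S ↪[mvLang] (X → unitInterval) :=
  mvEmbedding (fun s x => ⟨φ x s, (hφ x).nonneg s, (hφ x).le_one s⟩)
    (fun s t h => hinj s t fun x => congrArg Subtype.val (congrFun h x))
    (fuzzy_ext fun x => (hφ x).map_zero) (fun s => fuzzy_ext fun x => (hφ x).map_neg s)
    (fun s t => fuzzy_ext fun x => (hφ x).map_add s t)

/-- `s ⊕ s` acts on values as `2t` below `1/2`, and `¬(¬s ⊕ ¬s)` as `2t - 1` above it. While both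
values lie on the same side of `1/2` the gap doubles, which cannot go on; once `1/2` separates them,
the second operation kills the smaller value only. -/
theorem exists_char_eq_zero_of_lt {p q : S → ℝ} (hp : IsMVChar p) (hq : IsMVChar q) {s : S}
    (hs : p s < q s) : ∃ t, p t = 0 ∧ 0 < q t := by
  obtain ⟨n, hn⟩ := pow_unbounded_of_one_lt (1 / (q s - p s)) one_lt_two
  rw [div_lt_iff₀ (by linarith)] at hn
  induction n generalizing s with
  | zero =>
    have := hp.nonneg s
    have := hq.le_one s
    linarith
  | succ n ih =>
    rw [pow_succ] at hn
    rcases le_total (q s) (1 / 2) with h1 | h1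
    · refine ih (s := mvAdd s s) ?_ ?_ <;>
      · rw [hp.map_add, hq.map_add, min_eq_left (by linarith), min_eq_left (by linarith)]
        linarith
    · rcases le_total (1 / 2) (p s) with h2 | h2
      · refine ih (s := mvNeg (mvAdd (mvNeg s) (mvNeg s))) ?_ ?_ <;>
        · rw [hp.map_neg, hq.map_neg, hp.map_add, hq.map_add, hp.map_neg, hq.map_neg,
            min_eq_left (by linarith), min_eq_left (by linarith)]
          linarith
      -- At `q s = 1/2` exactly, `¬(¬s ⊕ ¬s)` would kill both values, so that case doubles instead.
      · rcases h1.lt_or_eq with h1 | h1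
        · refine ⟨mvNeg (mvAdd (mvNeg s) (mvNeg s)), ?_, ?_⟩
          · rw [hp.map_neg, hp.map_add, hp.map_neg, min_eq_right (by linarith), sub_self]
          · rw [hq.map_neg, hq.map_add, hq.map_neg, min_eq_left (by linarith)]
            linarith
        · refine ih (s := mvAdd s s) ?_ ?_ <;>
          · rw [hp.map_add, hq.map_add, min_eq_left (by linarith), min_eq_left (by linarith)]
            linarith

theorem exists_char_eq_zero_of_ne {p q : S → ℝ} (hp : IsMVChar p) (hq : IsMVChar q) {s : S}
    (hs : p s ≠ q s) : ∃ t, p t = 0 ∧ 0 < q t := by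
  rcases hs.lt_or_gt with h | h
  · exact exists_char_eq_zero_of_lt hp hq h
  · refine exists_char_eq_zero_of_lt hp hq (s := mvNeg s) ?_
    rw [hp.map_neg, hq.map_neg]
    linarith

theorem IsMVChar.map_neg_add_eq_zero {φ : S → ℝ} (hφ : IsMVChar φ) {s t : S} (h : φ s = φ t) :
    φ (mvNeg (mvAdd (mvNeg s) t)) = 0 := by
  rw [hφ.map_neg, hφ.map_add, hφ.map_neg, h, sub_add_cancel, min_self, sub_self]

/-- The infimum in an MV-algebra. -/
def mvInf (s t : S) : S := mvNeg (mvAdd (mvNeg s) (mvNeg (mvAdd (mvNeg s) t)))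

theorem IsMVChar.map_inf {φ : S → ℝ} (hφ : IsMVChar φ) (s t : S) :
    φ (mvInf s t) = min (φ s) (φ t) := by
  have := hφ.le_one s
  have := hφ.nonneg s
  have := hφ.nonneg t
  simp only [mvInf, hφ.map_neg, hφ.map_add]
  rcases le_total (φ s) (φ t) with h | h
  · rw [min_eq_left h, min_eq_right (by linarith : 1 ≤ 1 - φ s + φ t), min_eq_left (by linarith)]
    ring
  · rw [min_eq_right h, min_eq_left (by linarith : 1 - φ s + φ t ≤ 1), min_eq_left (by linarith)]
    ring

/-- Characters of an algebra of locally constant fuzzy sets on a compact space are evaluations. -/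
theorem exists_eq_eval [TopologicalSpace X] [CompactSpace X] (ι : S ↪[mvLang] (X → unitInterval))
    (hι : ∀ s, IsLocallyConstant (ι s)) {φ : S → ℝ} (hφ : IsMVChar φ) :
    ∃ x, ∀ s, φ s = ι s x := by
  by_contra! hne
  -- Each point has a neighbourhood on which some element with `φ > 0` vanishes. Infima glue these
  -- over finite unions, so compactness yields one vanishing everywhere.
  obtain ⟨t, ht, h0⟩ : ∃ t, 0 < φ t ∧ ∀ x ∈ (Set.univ : Set X), (ι t x : ℝ) = 0 := by
    refine isCompact_univ.induction_on (p := fun U => ∃ t, 0 < φ t ∧ ∀ x ∈ U, (ι t x : ℝ) = 0)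
      ?_ ?_ ?_ ?_
    · refine ⟨mvNeg (mvZero S), ?_, by simp⟩
      rw [hφ.map_neg, hφ.map_zero]
      norm_num
    · rintro U V hUV ⟨t, ht, h⟩
      exact ⟨t, ht, fun x hx => h x (hUV hx)⟩
    · rintro U V ⟨t, ht, h⟩ ⟨t', ht', h'⟩
      refine ⟨mvInf t t', ?_, fun x hx => ?_⟩
      · rw [hφ.map_inf]
        exact lt_min ht ht'
      · have hx' := ((isMVChar_eval x).comp ι).map_inf t t'
        have := (ι t x).2.1
        have := (ι t' x).2.1
        rw [hx']
        rcases hx with hx | hx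
        · rw [h x hx]; exact min_eq_left this
        · rw [h' x hx]; exact min_eq_right (by assumption)
    · intro x _
      obtain ⟨s, hs⟩ := hne x
      obtain ⟨t, ht, ht'⟩ := exists_char_eq_zero_of_ne ((isMVChar_eval x).comp ι) hφ hs.symm
      refine ⟨{y | ι t y = ι t x}, mem_nhdsWithin_of_mem_nhds ?_, t, ht', fun y hy => ?_⟩
      · exact (IsLocallyConstant.iff_eventually_eq _).1 (hι t) x
      · rw [Set.mem_ofPred_eq] at hy
        rw [hy]
        exact ht
  have : t = mvZero S := ι.injective (by
    rw [map_mvZero]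
    exact fuzzy_ext fun x => h0 x trivial)
  rw [this, hφ.map_zero] at ht
  exact lt_irrefl _ ht

end Characters

/-! ### Rational characters of finite MV-algebras. -/

section FiniteMV

open MVAlgebra

variable {S : Type u} [mvLang.Structure S] [Finite S]

/-- Dividing by `order a` turns truncation of coefficients at `order a` into truncation at `1`. -/
theorem isMVChar_coeff (hS : IsMVAlgebra S) {a : S} :
    letI := hS.toMVAlgebra
    IsMVAtom a → IsMVChar fun s => (coeff a s : ℝ) / order a := by
  let _ := hS.toMVAlgebra
  intro ha
  have hpos : (0 : ℝ) < order a := by exact_mod_cast ha.order_pos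
  constructor
  · intro s
    positivity
  · intro s
    rw [div_le_one hpos]
    exact_mod_cast coeff_le_order a s
  · have h := ha.coeff_zero
    change coeff a (mvZero S) = 0 at h
    rw [h]
    simp
  · intro s
    have h := ha.coeff_compl s
    change coeff a (mvNeg s) + _ = _ at h
    have h' : (coeff a (mvNeg s) : ℝ) + coeff a s = order a := by exact_mod_cast h
    rw [eq_sub_iff_add_eq, ← add_div, h', div_self hpos.ne']
  · intro s t
    have h := ha.coeff_add s t
    change coeff a (mvAdd s t) = _ at h
    rw [h, ← add_div, Nat.cast_min, Nat.cast_add, ← min_div_div_right hpos.le, div_self hpos.ne']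

/-- A nontrivial finite MV-algebra is separated by a nonempty finite set of rational characters. -/
theorem exists_chars (hS : IsMVAlgebra S) [Nontrivial S] :
    ∃ (F : Type u) (_ : Finite F) (_ : Nonempty F) (φ : F → S → ℝ), (∀ i, IsMVChar (φ i)) ∧
      (∀ i s, ∃ r : ℚ, φ i s = r) ∧ ∀ s t, (∀ i, φ i s = φ i t) → s = t := by
  let _ := hS.toMVAlgebra
  refine ⟨{a : S // IsMVAtom a}, inferInstance, ?_, fun a s => (coeff a.1 s : ℝ) / order a.1,
    fun a => isMVChar_coeff hS a.2, fun a s => ⟨coeff a.1 s / order a.1, by push_cast; rfl⟩, ?_⟩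
  · obtain ⟨x, hx⟩ := exists_ne (0 : S)
    obtain ⟨a, ha, -⟩ := exists_isMVAtom_le hx
    exact ⟨⟨a, ha⟩⟩
  · intro s t h
    -- A character agreeing on `s` and `t` kills `diff s t`, but an atom below `diff s t` would have
    -- a positive coefficient there.
    have key : ∀ s t : S, (∀ a : {a : S // IsMVAtom a},
        (coeff a.1 s : ℝ) / order a.1 = (coeff a.1 t : ℝ) / order a.1) → s ≤ t := by
      intro s t h
      rw [← diff_eq_zero_iff]
      by_contra hne
      obtain ⟨a, ha, hle⟩ := exists_isMVAtom_le hne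
      have hφ := isMVChar_coeff hS ha
      have h1 := hφ.map_neg_add_eq_zero (h ⟨a, ha⟩)
      rw [div_eq_zero_iff] at h1
      have h3 : 0 < coeff a (mvNeg (mvAdd (mvNeg s) t)) := ha.coeff_pos hle
      have h4 := ha.order_pos
      rcases h1 with h1 | h1
      · exact h3.ne' (by exact_mod_cast h1)
      · exact h4.ne' (by exact_mod_cast h1)
    exact le_antisymm (key s t h) (key t s fun a => (h a).symm)

end FiniteMV

/-! ### Constructing locally constant maps. -/

theorem isLocallyConstant_pi {X ι : Type*} {Y : ι → Type*} [TopologicalSpace X] [Finite ι]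
    {f : X → ∀ i, Y i} (hf : ∀ i, IsLocallyConstant fun x => f x i) : IsLocallyConstant f := by
  rw [IsLocallyConstant.iff_eventually_eq]
  intro x
  filter_upwards [Filter.eventually_all.2 fun i =>
    (IsLocallyConstant.iff_eventually_eq _).1 (hf i) x] with y hy
  exact funext hy

theorem isLocallyConstant_diag {X Y Z : Type*} [TopologicalSpace X] {q : X → Y} {κ : Y → X → Z}
    (hq : IsLocallyConstant q) (hκ : ∀ v, IsLocallyConstant (κ v)) :
    IsLocallyConstant fun x => κ (q x) x := by
  rw [IsLocallyConstant.iff_eventually_eq]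
  intro x
  filter_upwards [(IsLocallyConstant.iff_eventually_eq _).1 hq x,
    (IsLocallyConstant.iff_eventually_eq _).1 (hκ (q x)) x] with y h1 h2
  rw [h1, h2]

/-- In a perfect totally separated space, every nonempty open set is mapped onto a given nonempty
finite set by some locally constant map. -/
theorem exists_isLocallyConstant_surjOn {X F : Type*} [TopologicalSpace X]
    [TotallySeparatedSpace X] [PerfectSpace X] [Finite F] [Nonempty F] {U : Set X} (hU : IsOpen U)
    (hne : U.Nonempty) : ∃ κ : X → F, IsLocallyConstant κ ∧ ∀ i, ∃ x ∈ U, κ x = i := by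
  obtain ⟨x₀, hx₀⟩ := hne
  have hinf : U.Infinite := infinite_of_mem_nhds x₀ (hU.mem_nhds hx₀)
  have := hinf.to_subtype
  obtain ⟨p⟩ : Nonempty (F ↪ U) := by
    obtain ⟨n, ⟨e⟩⟩ := Finite.exists_equiv_fin F
    exact ⟨e.toEmbedding.trans (Fin.valEmbedding.trans (Infinite.natEmbedding U))⟩
  have hsep : ∀ i j : F, ∃ W : Set X, IsClopen W ∧ (i ≠ j → (p i : X) ∈ W ∧ (p j : X) ∉ W) := by
    intro i j
    by_cases h : i = j
    · exact ⟨Set.univ, isClopen_univ, fun h' => absurd h h'⟩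
    · obtain ⟨W, hW, h1, h2⟩ := exists_isClopen_of_totally_separated
        (fun h' => h (p.injective (Subtype.ext h')) : (p i : X) ≠ p j)
      exact ⟨W, hW, fun _ => ⟨h1, h2⟩⟩
  choose W hW hsep using hsep
  -- `G` records membership in the finitely many separating clopens; the patterns at the chosen
  -- points are distinct, so they can be decoded back to `F`.
  let G : X → F × F → Prop := fun x ij => x ∈ W ij.1 ij.2
  have hG : IsLocallyConstant G := isLocallyConstant_pi fun ij => by
    rw [IsLocallyConstant.iff_eventually_eq]
    intro x
    by_cases hx : x ∈ W ij.1 ij.2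
    · filter_upwards [(hW ij.1 ij.2).isOpen.mem_nhds hx] with y hy
      simp [G, hx, hy]
    · filter_upwards [(hW ij.1 ij.2).compl.isOpen.mem_nhds hx] with y hy
      have hy' : y ∉ W ij.1 ij.2 := hy
      simp [G, hx, hy']
  have hinj : Function.Injective fun i : F => G (p i) := by
    intro i j h
    by_contra hij
    have h1 : G (p i) (i, j) = G (p j) (i, j) := congrFun h (i, j)
    have h2 := hsep i j hij
    exact h2.2 (Eq.mp h1 h2.1)
  refine ⟨fun x => Function.invFun (fun i : F => G (p i)) (G x),
    hG.comp (Function.invFun fun i : F => G (p i)), fun i =>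
    ⟨p i, (p i).2, Function.leftInverse_invFun hinj i⟩⟩

/-! ### Algebras of locally constant functions: finiteness and back-and-forth. -/

section Representation

variable {X : Type*} [TopologicalSpace X] {S : Type*} [mvLang.Structure S]

/-- `ι` represents `S` as the algebra of all locally constant functions with values in `V`. -/
def IsLocConstRep (V : Set unitInterval) (ι : S ↪[mvLang] (X → unitInterval)) : Prop :=
  ∀ f, f ∈ Set.range ι ↔ IsLocallyConstant f ∧ ∀ x, f x ∈ V

/-- The rational points of the unit interval. -/
def rationalUnit : Set unitInterval := {q | ∃ r : ℚ, (q : ℝ) = r}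

variable {V : Set unitInterval} {ι : S ↪[mvLang] (X → unitInterval)}

theorem IsLocConstRep.isLocallyConstant (h : IsLocConstRep V ι) (s : S) : IsLocallyConstant (ι s) :=
  ((h _).1 ⟨s, rfl⟩).1

theorem IsLocConstRep.mem (h : IsLocConstRep V ι) (s : S) (x : X) : ι s x ∈ V :=
  ((h _).1 ⟨s, rfl⟩).2 x

/-- An embedding into a fuzzy power whose values are in the range of `ι` lifts along `ι`. -/
theorem exists_lift {T Y : Type*} [mvLang.Structure T] (ι : S ↪[mvLang] (Y → unitInterval))
    (g : T ↪[mvLang] (Y → unitInterval)) (hg : ∀ t, g t ∈ Set.range ι) :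
    ∃ f : T ↪[mvLang] S, ∀ t, ι (f t) = g t := by
  choose f hf using hg
  refine ⟨mvEmbedding f (fun t t' h => g.injective (by rw [← hf, h, hf])) (ι.injective ?_)
    (fun t => ι.injective ?_) (fun t t' => ι.injective ?_), hf⟩
  · rw [hf, map_mvZero, map_mvZero]
  · rw [hf, map_mvNeg, map_mvNeg, hf]
  · rw [hf, map_mvAdd, map_mvAdd, hf, hf]

/-- The multiples of `1 / N` in the unit interval. -/
def unitFractions (N : ℕ) : Set unitInterval := {q | ∃ k : ℕ, (q : ℝ) * N = k}

theorem finite_unitFractions {N : ℕ} (hN : 0 < N) : (unitFractions N).Finite := by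
  have hN' : (0 : ℝ) < N := by exact_mod_cast hN
  refine (((Finset.range (N + 1)).finite_toSet.image fun k : ℕ => (k : ℝ) / N).preimage
    Subtype.val_injective.injOn).subset ?_
  rintro q ⟨k, hk⟩
  refine ⟨k, ?_, ?_⟩
  · have : (k : ℝ) ≤ N := by
      rw [← hk]
      exact mul_le_of_le_one_left hN'.le q.2.2
    rw [Finset.mem_coe, Finset.mem_range, Nat.lt_succ_iff]
    exact_mod_cast this
  · rw [div_eq_iff hN'.ne', hk]

theorem exists_subset_unitFractions {W : Set unitInterval} (hW : W.Finite) (hV : W ⊆ rationalUnit) :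
    ∃ N, 0 < N ∧ W ⊆ unitFractions N := by
  induction W, hW using Set.Finite.induction_on with
  | empty => exact ⟨1, one_pos, Set.empty_subset _⟩
  | @insert q W _ _ ih =>
    obtain ⟨N, hN, hWN⟩ := ih ((Set.subset_insert _ _).trans hV)
    obtain ⟨r, hr⟩ := hV (Set.mem_insert _ _)
    refine ⟨r.den * N, Nat.mul_pos r.den_pos hN, Set.insert_subset ?_ ?_⟩
    · have hr0 : 0 ≤ r.num := by
        rw [Rat.num_nonneg]
        have := q.2.1
        rw [hr] at this
        exact_mod_cast this
      obtain ⟨m, hm⟩ := Int.eq_ofNat_of_zero_le hr0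
      refine ⟨m * N, ?_⟩
      have h1 : (r : ℝ) * r.den = m := by
        have h2 := Rat.mul_den_eq_num r
        rw [hm] at h2
        exact_mod_cast h2
      push_cast
      rw [hr, ← mul_assoc, h1]
    · intro w hw
      obtain ⟨k, hk⟩ := hWN hw
      refine ⟨r.den * k, ?_⟩
      push_cast
      rw [← hk]
      ring

/-- Finitely generated algebras of rational-valued locally constant functions are finite. -/
theorem IsLocConstRep.finite_of_fg [CompactSpace X] (h : IsLocConstRep V ι)
    (hV : V ⊆ rationalUnit) {K : mvLang.Substructure S} (hK : K.FG) : Finite K := by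
  obtain ⟨G, hG, rfl⟩ := Substructure.fg_def.1 hK
  have := hG.to_subtype
  let P : X → G → unitInterval := fun x g => ι g x
  have hP : IsLocallyConstant P := isLocallyConstant_pi fun g => h.isLocallyConstant g
  have hfin : (⋃ g ∈ G, Set.range (ι g)).Finite :=
    hG.biUnion fun g _ => (h.isLocallyConstant g).range_finite
  obtain ⟨N, hN, hWN⟩ := exists_subset_unitFractions hfin (by
    refine Set.iUnion₂_subset fun g _ => ?_
    rintro _ ⟨x, rfl⟩
    exact hV (h.mem g x))
  -- `D` consists of the functions with values in multiples of `1 / N` that are constant on the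
  -- fibres of `P`. It contains the generators, and it is finite because one sample per fibre
  -- determines an element.
  let D : mvLang.Substructure S := mvSubstructure
    {s | (∀ x, ι s x ∈ unitFractions N) ∧ ∀ x y, P x = P y → ι s x = ι s y}
    (by
      rw [Set.mem_ofPred_eq, map_mvZero]
      exact ⟨fun x => ⟨0, by rw [fuzzy_mvZero]; simp⟩, fun x y _ => rfl⟩)
    (by
      rintro s ⟨h1, h2⟩
      rw [Set.mem_ofPred_eq, map_mvNeg]
      refine ⟨fun x => ?_, fun x y hxy => Subtype.ext ?_⟩
      · obtain ⟨k, hk⟩ := h1 x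
        have hle : k ≤ N := by
          have : (k : ℝ) ≤ N := by
            rw [← hk]
            exact mul_le_of_le_one_left (Nat.cast_nonneg _) (ι s x).2.2
          exact_mod_cast this
        refine ⟨N - k, ?_⟩
        rw [fuzzy_mvNeg, sub_mul, hk, one_mul, Nat.cast_sub hle]
      · rw [fuzzy_mvNeg, fuzzy_mvNeg, h2 x y hxy])
    (by
      rintro s ⟨h1, h2⟩ t ⟨h3, h4⟩
      rw [Set.mem_ofPred_eq, map_mvAdd]
      refine ⟨fun x => ?_, fun x y hxy => Subtype.ext ?_⟩
      · obtain ⟨k, hk⟩ := h1 x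
        obtain ⟨l, hl⟩ := h3 x
        refine ⟨min (k + l) N, ?_⟩
        rw [fuzzy_mvAdd, min_mul_of_nonneg _ _ (Nat.cast_nonneg _), add_mul, hk, hl, one_mul]
        push_cast
        rfl
      · rw [fuzzy_mvAdd, fuzzy_mvAdd, h2 x y hxy, h4 x y hxy])
  have hle : Substructure.closure mvLang G ≤ D := by
    rw [Substructure.closure_le]
    intro g hg
    refine ⟨fun x => hWN (Set.mem_biUnion hg ⟨x, rfl⟩), fun x y hxy => congrFun hxy ⟨g, hg⟩⟩
  have := hP.range_finite.to_subtype
  have := (finite_unitFractions hN).to_subtype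
  let E : D → Set.range P → unitFractions N := fun s c => ⟨ι s c.2.choose, s.2.1 _⟩
  have hE : Function.Injective E := by
    intro s t hst
    refine Subtype.ext (ι.injective (funext fun x => ?_))
    have h1 := congrArg Subtype.val (congrFun hst ⟨P x, x, rfl⟩)
    have h2 : P (Exists.choose (⟨x, rfl⟩ : ∃ y, P y = P x)) = P x :=
      Exists.choose_spec (⟨x, rfl⟩ : ∃ y, P y = P x)
    rw [← s.2.2 _ _ h2, ← t.2.2 _ _ h2]
    exact h1
  have : Finite D := Finite.of_injective E hE
  exact Finite.of_injective (Substructure.inclusion hle) (Substructure.inclusion hle).injective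

/-- The back-and-forth property for algebras of locally constant functions. -/
theorem IsLocConstRep.isExtensionPair [CompactSpace X] {Y : Type*} [TopologicalSpace Y]
    [CompactSpace Y] [TotallySeparatedSpace Y] [PerfectSpace Y] {T : Type*} [mvLang.Structure T]
    {ι' : T ↪[mvLang] (Y → unitInterval)} (h : IsLocConstRep V ι) (h' : IsLocConstRep V ι')
    (hV : V ⊆ rationalUnit) : mvLang.IsExtensionPair S T := by
  rw [isExtensionPair_iff_exists_embedding_closure_singleton_sup]
  intro S₀ hS₀ f m
  set S₁ := Substructure.closure mvLang {m} ⊔ S₀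
  have hle : S₀ ≤ S₁ := le_sup_right
  have hfin₁ : Finite S₁ := h.finite_of_fg hV ((Substructure.fg_closure_singleton _).sup hS₀)
  have hfin₀ : Finite S₀ := h.finite_of_fg hV hS₀
  let P : X → S₁ → unitInterval := fun x s => ι s x
  have hP : IsLocallyConstant P := isLocallyConstant_pi fun s => h.isLocallyConstant s
  have hPfin := hP.range_finite.to_subtype
  let Q : Y → S₀ → unitInterval := fun y s => ι' (f s) y
  have hQ : IsLocallyConstant Q := isLocallyConstant_pi fun s => h'.isLocallyConstant (f s)
  -- Elements of `Set.range P` and `Set.range Q` are characters of `S₁` and `S₀`, and `res` is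
  -- restriction. As characters are evaluations, `res` and `Q` have the same image.
  let res : Set.range P → S₀ → unitInterval := fun p s => p.1 (Substructure.inclusion hle s)
  have hpt : ∀ y, ∃ p, res p = Q y := by
    intro y
    obtain ⟨x, hx⟩ := exists_eq_eval (ι.comp S₀.subtype) (fun s => h.isLocallyConstant _)
      ((isMVChar_eval y).comp (ι'.comp f))
    exact ⟨⟨P x, x, rfl⟩, funext fun s => Subtype.ext (hx s).symm⟩
  have hsurj : ∀ p, ∃ y, Q y = res p := by
    rintro ⟨_, x, rfl⟩
    obtain ⟨y, hy⟩ := exists_eq_eval (ι'.comp f) (fun s => h'.isLocallyConstant _)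
      ((isMVChar_eval x).comp (ι.comp S₀.subtype))
    exact ⟨y, funext fun s => Subtype.ext (hy s).symm⟩
  -- Perfectness enters here: each fibre of `Q` is cut into enough pieces to carry every extension
  -- of its character to `S₁`.
  have hsplit : ∀ v : Set.range Q, ∃ κ : Y → {p // res p = v}, IsLocallyConstant κ ∧
      ∀ i, ∃ y ∈ Q ⁻¹' {v.1}, κ y = i := by
    rintro ⟨_, y, rfl⟩
    obtain ⟨p, hp⟩ := hpt y
    have : Nonempty {p // res p = Q y} := ⟨⟨p, hp⟩⟩
    exact exists_isLocallyConstant_surjOn (hQ.isOpen_fiber _) ⟨y, rfl⟩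
  choose κ hκ hκs using hsplit
  let k : Y → Set.range P := fun y => (κ ⟨Q y, y, rfl⟩ y).1
  have hk : IsLocallyConstant k := isLocallyConstant_diag
    (q := fun y => (⟨Q y, y, rfl⟩ : Set.range Q)) (κ := fun v y => (κ v y).1)
    (IsLocallyConstant.desc _ Subtype.val hQ Subtype.val_injective) fun v => (hκ v).comp Subtype.val
  have hkres : ∀ y, res (k y) = Q y := fun y => (κ ⟨Q y, y, rfl⟩ y).2
  have hksurj : Function.Surjective k := by
    intro p
    obtain ⟨y, hy⟩ := hsurj p
    obtain ⟨y', hy', hy''⟩ := hκs ⟨Q y, y, rfl⟩ ⟨p, hy.symm⟩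
    refine ⟨y', ?_⟩
    have h1 : (⟨Q y', y', rfl⟩ : Set.range Q) = ⟨Q y, y, rfl⟩ := Subtype.ext hy'
    change (κ ⟨Q y', y', rfl⟩ y').1 = p
    rw [h1, hy'']
  have hchar : ∀ p : Set.range P, IsMVChar fun s => (p.1 s : ℝ) := by
    rintro ⟨_, x, rfl⟩
    exact (isMVChar_eval x).comp (ι.comp S₁.subtype)
  -- The extension sends `s` to `y ↦ k y s`: surjectivity of `k` makes it injective, and `res (k y)
  -- = Q y` makes it extend `f`.
  obtain ⟨g, hg⟩ := exists_lift ι' (embeddingOfChars (fun y s => ((k y).1 s : ℝ))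
    (fun y => hchar (k y)) (by
      intro s t hst
      refine Subtype.ext (ι.injective (funext fun x => ?_))
      obtain ⟨y, hy⟩ := hksurj ⟨P x, x, rfl⟩
      have h1 := hst y
      rw [hy] at h1
      exact Subtype.ext h1)) (by
      intro s
      rw [h']
      constructor
      · exact hk.comp fun p => p.1 s
      · intro y
        obtain ⟨x, hx⟩ := (k y).2
        have h1 : (k y).1 s ∈ V := by
          rw [← hx]
          exact h.mem s x
        exact h1)
  refine ⟨g, Embedding.ext fun s => ι'.injective ?_⟩
  rw [Embedding.comp_apply, hg]
  exact funext fun y => (congrFun (hkres y) s).symm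

/-- The algebra of locally constant rational-valued functions on a nonempty perfect Stone space is
a Fraïssé limit of the finite MV-algebras. -/
theorem isFraisseLimit_of_isLocConstRep {X : Type v} [TopologicalSpace X] [CompactSpace X]
    [TotallySeparatedSpace X] [PerfectSpace X] [Nonempty X] {S : Type u} [mvLang.Structure S]
    [Countable S] {ι : S ↪[mvLang] (X → unitInterval)} (h : IsLocConstRep rationalUnit ι) :
    IsFraisseLimit finiteMV.{u} S where
  ultrahomogeneous := (isUltrahomogeneous_iff_IsExtensionPair Structure.cg_of_countable).2
    (h.isExtensionPair h subset_rfl)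
  age := by
    ext N
    constructor
    · rintro ⟨hfg, ⟨f⟩⟩
      refine ⟨(fuzzy_isMVAlgebra X).of_injective (ι.comp f) (ι.comp f).injective, ?_,
        ⟨⟨mvZero N, mvNeg (mvZero N), fun h0 => ?_⟩⟩⟩
      · have := h.finite_of_fg subset_rfl (hfg.range f.toHom)
        exact Finite.of_injective f.equivRange f.equivRange.injective
      · have h1 := congrArg (ι.comp f) h0
        rw [map_mvNeg, map_mvZero] at h1
        have x : X := Classical.arbitrary X
        have h2 := congrArg Subtype.val (congrFun h1 x)
        rw [fuzzy_mvNeg, fuzzy_mvZero] at h2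
        norm_num at h2
    · rintro ⟨hN, hfin, hnt⟩
      refine ⟨Structure.FG.of_finite, ?_⟩
      obtain ⟨F, _, _, φ, hφ, hrat, hinj⟩ := exists_chars hN
      obtain ⟨κ, hκ, hκs⟩ := exists_isLocallyConstant_surjOn (F := F) (isOpen_univ (X := X))
        Set.univ_nonempty
      -- Pulling the separating characters back along a locally constant map onto their index set
      -- embeds `N`.
      obtain ⟨f, -⟩ := exists_lift ι (embeddingOfChars (fun x => φ (κ x)) (fun x => hφ _) (by
        intro s t hst
        refine hinj s t fun i => ?_
        obtain ⟨x, -, rfl⟩ := hκs i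
        exact hst x)) (by
        intro s
        rw [h]
        refine ⟨hκ.comp fun i => (⟨φ i s, (hφ i).nonneg s, (hφ i).le_one s⟩ : unitInterval),
          fun x => hrat (κ x) s⟩)
      exact ⟨f⟩

end Representation

/-! ### Automorphisms as self-homeomorphisms. -/

section Automorphisms

variable {X : Type*} [TopologicalSpace X] {S : Type*} [mvLang.Structure S]
variable {V : Set unitInterval} {ι : S ↪[mvLang] (X → unitInterval)}

/-- The two-element subalgebra of the unit interval. -/
def booleanUnit : Set unitInterval := {0, 1}

theorem IsClopen.isLocallyConstant_indicator_one {U : Set X} (hU : IsClopen U) :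
    IsLocallyConstant (U.indicator fun _ => (1 : unitInterval)) := by
  rw [IsLocallyConstant.iff_eventually_eq]
  intro x
  by_cases hx : x ∈ U
  · filter_upwards [hU.isOpen.mem_nhds hx] with y hy
    rw [Set.indicator_of_mem hx, Set.indicator_of_mem hy]
  · filter_upwards [hU.compl.isOpen.mem_nhds hx] with y hy
    rw [Set.indicator_of_notMem hx, Set.indicator_of_notMem hy]

theorem IsLocConstRep.exists_indicator (h : IsLocConstRep V ι) (hV : booleanUnit ⊆ V) {U : Set X}
    (hU : IsClopen U) : ∃ s, ι s = U.indicator fun _ => 1 := by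
  refine (h _).2 ⟨hU.isLocallyConstant_indicator_one, fun x => hV ?_⟩
  by_cases hx : x ∈ U
  · exact Or.inr (Set.indicator_of_mem hx _)
  · exact Or.inl (Set.indicator_of_notMem hx _)

theorem IsLocConstRep.eq_of_forall [TotallySeparatedSpace X] (h : IsLocConstRep V ι)
    (hV : booleanUnit ⊆ V) {x y : X} (hxy : ∀ s, ι s x = ι s y) : x = y := by
  by_contra hne
  obtain ⟨U, hU, hx, hy⟩ := exists_isClopen_of_totally_separated hne
  obtain ⟨s, hs⟩ := h.exists_indicator hV hU
  have h1 := hxy s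
  rw [hs, Set.indicator_of_mem hx, Set.indicator_of_notMem hy] at h1
  exact one_ne_zero h1

theorem IsLocConstRep.exists_comp (h : IsLocConstRep V ι) (k : X ≃ₜ X) (s : S) :
    ∃ t, ι t = ι s ∘ k := by
  refine (h _).2 ⟨(h.isLocallyConstant s).comp_continuous k.continuous, fun x => h.mem s _⟩

/-- The action of a self-homeomorphism on locally constant functions. -/
noncomputable def IsLocConstRep.compHomeomorph (h : IsLocConstRep V ι) (k : X ≃ₜ X) :
    S ≃[mvLang] S :=
  mvEquiv
    { toFun := fun s => (h.exists_comp k.symm s).choose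
      invFun := fun s => (h.exists_comp k s).choose
      left_inv := fun s => ι.injective (by
        rw [(h.exists_comp k _).choose_spec, (h.exists_comp k.symm s).choose_spec]
        funext x
        simp)
      right_inv := fun s => ι.injective (by
        rw [(h.exists_comp k.symm _).choose_spec, (h.exists_comp k s).choose_spec]
        funext x
        simp) }
    (ι.injective (by
      rw [Equiv.coe_fn_mk, (h.exists_comp k.symm _).choose_spec, map_mvZero]
      rfl))
    (fun s => ι.injective (by
      rw [Equiv.coe_fn_mk, (h.exists_comp k.symm _).choose_spec, map_mvNeg, map_mvNeg,
        (h.exists_comp k.symm s).choose_spec]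
      rfl))
    (fun s t => ι.injective (by
      rw [Equiv.coe_fn_mk, (h.exists_comp k.symm _).choose_spec, map_mvAdd, map_mvAdd,
        (h.exists_comp k.symm s).choose_spec, (h.exists_comp k.symm t).choose_spec]
      rfl))

theorem IsLocConstRep.compHomeomorph_apply (h : IsLocConstRep V ι) (k : X ≃ₜ X) (s : S) (x : X) :
    ι (h.compHomeomorph k s) x = ι s (k.symm x) :=
  congrFun (h.exists_comp k.symm s).choose_spec x

variable [CompactSpace X] [TotallySeparatedSpace X]

/-- `s ↦ (σ s)(x)` is a character, hence evaluation at some `k x`. Preimages of clopens under `k`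
are level sets of images of indicators, hence open. -/
theorem IsLocConstRep.exists_continuous (h : IsLocConstRep V ι) (hV : booleanUnit ⊆ V)
    (σ : S ≃[mvLang] S) : ∃ k : X → X, Continuous k ∧ ∀ s x, ι (σ s) x = ι s (k x) := by
  choose k hk using fun x =>
    exists_eq_eval ι h.isLocallyConstant ((isMVChar_eval x).comp (ι.comp σ.toEmbedding))
  have hk' : ∀ s x, ι (σ s) x = ι s (k x) := fun s x => Subtype.ext (hk x s)
  refine ⟨k, ?_, hk'⟩
  rw [isTopologicalBasis_isClopen.continuous_iff]
  intro U hU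
  obtain ⟨s, hs⟩ := h.exists_indicator hV hU
  have h1 : k ⁻¹' U = {x | ι (σ s) x = 1} := by
    ext x
    rw [Set.mem_preimage, Set.mem_ofPred_eq, hk', hs]
    by_cases hx : k x ∈ U
    · simp [hx]
    · simp [hx]
  rw [h1]
  exact (h.isLocallyConstant (σ s)).isOpen_fiber 1

theorem IsLocConstRep.compHomeomorph_bijective (h : IsLocConstRep V ι) (hV : booleanUnit ⊆ V) :
    Function.Bijective h.compHomeomorph := by
  constructor
  · intro k l hkl
    have h1 : k.symm = l.symm := by
      ext x
      refine h.eq_of_forall hV fun s => ?_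
      rw [← h.compHomeomorph_apply, ← h.compHomeomorph_apply, hkl]
    exact Homeomorph.symm_bijective.injective h1
  · intro σ
    obtain ⟨k, hk, hk'⟩ := h.exists_continuous hV σ
    obtain ⟨l, hl, hl'⟩ := h.exists_continuous hV σ.symm
    -- The forward map is `l`, coming from `σ.symm`, because a homeomorphism acts by composition
    -- with its inverse.
    refine ⟨⟨⟨l, k, fun x => ?_, fun x => ?_⟩, hl, hk⟩, ?_⟩
    · refine h.eq_of_forall hV fun s => ?_
      rw [← hk', ← hl', FirstOrder.Language.Equiv.symm_apply_apply]
    · refine h.eq_of_forall hV fun s => ?_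
      rw [← hl', ← hk', FirstOrder.Language.Equiv.apply_symm_apply]
    · refine FirstOrder.Language.Equiv.ext fun s => ι.injective (funext fun x => ?_)
      rw [h.compHomeomorph_apply, hk']
      rfl

/-- The automorphisms of an algebra of locally constant functions on a Stone space are induced by
the self-homeomorphisms of the space. -/
noncomputable def IsLocConstRep.homeomorphMulEquiv (h : IsLocConstRep V ι) (hV : booleanUnit ⊆ V) :
    (X ≃ₜ X) ≃* (S ≃[mvLang] S) :=
  MulEquiv.mk' (Equiv.ofBijective _ (h.compHomeomorph_bijective hV)) (by
    intro k l
    refine FirstOrder.Language.Equiv.ext fun s => ι.injective (funext fun x => ?_)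
    change ι (h.compHomeomorph (k * l) s) x = ι (h.compHomeomorph k (h.compHomeomorph l s)) x
    rw [h.compHomeomorph_apply, h.compHomeomorph_apply, h.compHomeomorph_apply]
    rfl)

theorem IsLocConstRep.homeomorphMulEquiv_apply (h : IsLocConstRep V ι) (hV : booleanUnit ⊆ V)
    (k : X ≃ₜ X) (s : S) (x : X) : ι (h.homeomorphMulEquiv hV k s) x = ι s (k.symm x) :=
  h.compHomeomorph_apply k s x

end Automorphisms

/-! ### The Boolean center as the `{0,1}`-valued functions. -/

section BooleanCenter

variable {X : Type*} {M : Type*} [mvLang.Structure M]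

/-- In `[0,1]`, `min (2t) 1 = t` only for `t = 0` and `t = 1`. -/
theorem mem_booleanCenter_iff (ι : M ↪[mvLang] (X → unitInterval)) (hM : IsMVAlgebra M) (b : M) :
    b ∈ booleanCenter hM ↔ ∀ x, ι b x ∈ booleanUnit := by
  change mvAdd b b = b ↔ _
  rw [← ι.injective.eq_iff, map_mvAdd, funext_iff]
  refine forall_congr' fun x => ?_
  rw [Subtype.ext_iff, fuzzy_mvAdd]
  have h0 := (ι b x).2.1
  have h1 := (ι b x).2.2
  constructor
  · intro h
    rcases le_total ((ι b x : ℝ) + ι b x) 1 with h2 | h2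
    · rw [min_eq_left h2] at h
      exact Or.inl (Subtype.ext (show (ι b x : ℝ) = 0 by linarith))
    · rw [min_eq_right h2] at h
      exact Or.inr (Subtype.ext h.symm)
  · rintro (h | h) <;> rw [h] <;> simp

theorem IsLocConstRep.booleanCenter [TopologicalSpace X] {V : Set unitInterval}
    {ι : M ↪[mvLang] (X → unitInterval)} (h : IsLocConstRep V ι) (hV : booleanUnit ⊆ V)
    (hM : IsMVAlgebra M) :
    IsLocConstRep booleanUnit (ι.comp (booleanCenter hM).subtype) := by
  intro f
  constructor
  · rintro ⟨b, rfl⟩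
    exact ⟨h.isLocallyConstant b.1, (mem_booleanCenter_iff ι hM b.1).1 b.2⟩
  · rintro ⟨hf, hf'⟩
    obtain ⟨b, rfl⟩ := (h f).2 ⟨hf, fun x => hV (hf' x)⟩
    exact ⟨⟨b, (mem_booleanCenter_iff ι hM b).2 hf'⟩, rfl⟩

end BooleanCenter

/-! ### Stone duality and the countable atomless Boolean algebra. -/

section BooleanAlgebras

variable {B : Type v} [BooleanAlgebra B]

/-- A Boolean algebra as an MV-algebra. -/
@[reducible] def booleanMVStructure (B : Type v) [BooleanAlgebra B] : mvLang.Structure B :=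
  mvStructure ⊥ compl (· ⊔ ·)

/-- The elements of a Boolean algebra are the idempotents of its Boolean ring. -/
def idempotentOrderIso (B : Type v) [BooleanAlgebra B] :
    B ≃o {e : AsBoolRing B // IsIdempotentElem e} where
  toFun b := ⟨toBoolRing b, BooleanRing.isIdempotentElem _⟩
  invFun e := ofBoolRing e.1
  left_inv _ := rfl
  right_inv _ := rfl
  map_rel_iff' {a b} := by
    change toBoolRing a * toBoolRing b = toBoolRing a ↔ _
    rw [← toBoolRing_inf, toBoolRing_inj, inf_eq_left]

/-- Stone representation of a Boolean algebra. -/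
noncomputable def stoneOrderIso (B : Type v) [BooleanAlgebra B] :
    B ≃o TopologicalSpace.Clopens (PrimeSpectrum (AsBoolRing B)) :=
  (idempotentOrderIso B).trans PrimeSpectrum.isIdempotentElemEquivClopens

/-- Every element is idempotent, so all basic opens are clopen, and distinct primes differ on some
element. -/
instance (R : Type*) [BooleanRing R] : TotallySeparatedSpace (PrimeSpectrum R) := by
  rw [totallySeparatedSpace_iff_exists_isClopen]
  have hclopen : ∀ e : R, IsClopen (PrimeSpectrum.basicOpen e : Set (PrimeSpectrum R)) := fun e =>
    (PrimeSpectrum.isIdempotentElemEquivClopens ⟨e, BooleanRing.isIdempotentElem e⟩).isClopen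
  intro x y hxy
  obtain ⟨e, he⟩ : ∃ e, ¬ (e ∈ x.asIdeal ↔ e ∈ y.asIdeal) := by
    by_contra! h
    exact hxy (PrimeSpectrum.ext (Ideal.ext h))
  by_cases hx : e ∈ x.asIdeal
  · have hy : e ∉ y.asIdeal := fun hy => he ⟨fun _ => hy, fun _ => hx⟩
    exact ⟨_, (hclopen e).compl, fun h => h hx, fun h => h hy⟩
  · have hy : e ∈ y.asIdeal := by
      by_contra hy
      exact he ⟨fun h => absurd h hx, fun h => absurd h hy⟩
    exact ⟨_, hclopen e, hx, fun h => h hy⟩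

theorem exists_isLocConstRep_of_orderIso {X : Type*} [TopologicalSpace X]
    (D : B ≃o TopologicalSpace.Clopens X) :
    let _ := booleanMVStructure B
    ∃ ι : B ↪[mvLang] (X → unitInterval), IsLocConstRep booleanUnit ι := by
  intro _
  classical
  let χ : B → X → unitInterval := fun b => (D b : Set X).indicator fun _ => 1
  have hχ : ∀ b x, χ b x = if x ∈ (D b : Set X) then 1 else 0 := fun b x => by
    simp only [χ, Set.indicator_apply]
  have hinj : Function.Injective χ := by
    intro a b hab
    refine D.injective (SetLike.coe_injective (Set.ext fun x => ?_))
    have h1 := congrFun hab x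
    rw [hχ, hχ] at h1
    by_cases ha : x ∈ (D a : Set X) <;> by_cases hb : x ∈ (D b : Set X) <;> simp_all
  refine ⟨mvEmbedding χ hinj ?_ ?_ ?_, ?_⟩
  · refine funext fun x => Subtype.ext ?_
    change (χ ⊥ x : ℝ) = _
    rw [hχ, map_bot, fuzzy_mvZero]
    simp
  · refine fun a => funext fun x => Subtype.ext ?_
    change (χ aᶜ x : ℝ) = _
    rw [fuzzy_mvNeg, hχ, hχ, map_compl, TopologicalSpace.Clopens.coe_compl]
    by_cases ha : x ∈ (D a : Set X) <;> simp [ha]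
  · refine fun a b => funext fun x => Subtype.ext ?_
    change (χ (a ⊔ b) x : ℝ) = _
    rw [fuzzy_mvAdd, hχ, hχ, hχ, map_sup, TopologicalSpace.Clopens.coe_sup]
    by_cases ha : x ∈ (D a : Set X) <;> by_cases hb : x ∈ (D b : Set X) <;> simp [ha, hb]
  · intro f
    constructor
    · rintro ⟨b, rfl⟩
      refine ⟨(D b).isClopen.isLocallyConstant_indicator_one, fun x => ?_⟩
      change χ b x ∈ _
      rw [hχ]
      split_ifs
      · exact Or.inr rfl
      · exact Or.inl rfl
    · rintro ⟨hf, hf'⟩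
      refine ⟨D.symm ⟨f ⁻¹' {1}, hf.isClopen_fiber 1⟩, funext fun x => ?_⟩
      change χ _ x = _
      rw [hχ, OrderIso.apply_symm_apply]
      rcases hf' x with h | h
      · rw [if_neg, h]
        exact fun h1 : f x = 1 => zero_ne_one (h.symm.trans h1)
      · rw [if_pos, h]
        exact h

/-- An isolated point would be a clopen singleton, that is, an atom. -/
theorem perfectSpace_of_orderIso_clopens {X : Type*} [TopologicalSpace X] [T1Space X]
    (D : B ≃o TopologicalSpace.Clopens X) (hB : ∀ b : B, ¬ IsAtom b) : PerfectSpace X := by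
  rw [perfectSpace_iff_forall_not_isolated]
  intro x
  rw [Filter.neBot_iff, Ne, ← isOpen_singleton_iff_punctured_nhds]
  intro hx
  refine hB (D.symm ⟨{x}, isClosed_singleton, hx⟩) ?_
  rw [OrderIso.isAtom_iff]
  refine ⟨fun h => ?_, fun U hU => ?_⟩
  · have h1 := congrArg (fun U : TopologicalSpace.Clopens X => (U : Set X)) h
    exact Set.singleton_ne_empty x h1
  · have h1 : (U : Set X) ⊂ {x} := hU
    exact SetLike.coe_injective (Set.ssubset_singleton_iff.1 h1)

theorem booleanUnit_subset_rationalUnit : booleanUnit ⊆ rationalUnit := by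
  rintro _ (rfl | rfl)
  · exact ⟨0, by simp⟩
  · exact ⟨1, by simp⟩

/-- Countable algebras of locally constant functions on nonempty perfect Stone spaces, with the same
rational values, are isomorphic. -/
theorem IsLocConstRep.nonempty_equiv {V : Set unitInterval} (hV : V ⊆ rationalUnit)
    {X Y S T : Type*} [TopologicalSpace X] [CompactSpace X] [TotallySeparatedSpace X]
    [PerfectSpace X] [Nonempty X] [TopologicalSpace Y] [CompactSpace Y] [TotallySeparatedSpace Y]
    [PerfectSpace Y] [Nonempty Y] [mvLang.Structure S] [mvLang.Structure T] [Countable S]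
    [Countable T] {ι : S ↪[mvLang] (X → unitInterval)} {ι' : T ↪[mvLang] (Y → unitInterval)}
    (h : IsLocConstRep V ι) (h' : IsLocConstRep V ι') : Nonempty (S ≃[mvLang] T) := by
  obtain ⟨x₀⟩ := ‹Nonempty X›
  obtain ⟨y₀⟩ := ‹Nonempty Y›
  -- Back-and-forth needs a starting partial isomorphism. The least subalgebra contains only
  -- constant functions, so its values at `x₀` transfer to constants on `Y`.
  have hconst : (⊥ : mvLang.Substructure S) ≤ mvSubstructure {s | ∀ x, ι s x = ι s x₀}
      (by
        intro x
        rw [map_mvZero]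
        rfl)
      (by
        intro s hs x
        rw [map_mvNeg]
        exact Subtype.ext (by rw [fuzzy_mvNeg, fuzzy_mvNeg, hs x]))
      (by
        intro s hs t ht x
        rw [map_mvAdd]
        exact Subtype.ext (by rw [fuzzy_mvAdd, fuzzy_mvAdd, hs x, ht x])) := bot_le
  obtain ⟨g, -⟩ := exists_lift ι' (embeddingOfChars
    (fun _ (s : (⊥ : mvLang.Substructure S)) => (ι s x₀ : ℝ))
    (fun _ => (isMVChar_eval x₀).comp (ι.comp (Substructure.subtype _))) (by
      intro s t hst
      refine Subtype.ext (ι.injective (funext fun x => ?_))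
      rw [hconst s.2 x, hconst t.2 x]
      exact Subtype.ext (hst y₀))) (by
    intro s
    rw [h']
    exact ⟨IsLocallyConstant.const (ι s x₀), fun _ => h.mem s x₀⟩)
  obtain ⟨f, -⟩ := equiv_between_cg Structure.cg_of_countable Structure.cg_of_countable
    ⟨⟨⊥, g.toHom.range, g.equivRange⟩, Substructure.fg_bot⟩ (h.isExtensionPair h' hV)
    (h'.isExtensionPair h hV)
  exact ⟨f⟩

/-- Uniqueness of the countable atomless Boolean algebra, for algebras of clopen sets. -/
theorem IsLocConstRep.exists_equiv_booleanAlgebra [Countable B] [Nontrivial B]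
    (hB : ∀ b : B, ¬ IsAtom b) {X S : Type*} [TopologicalSpace X] [CompactSpace X]
    [TotallySeparatedSpace X] [PerfectSpace X] [Nonempty X] [mvLang.Structure S]
    [Countable S] {ι : S ↪[mvLang] (X → unitInterval)} (h : IsLocConstRep booleanUnit ι) :
    ∃ e : S ≃ B, e (mvZero S) = ⊥ ∧ (∀ x, e (mvNeg x) = (e x)ᶜ) ∧
      ∀ x y, e (mvAdd x y) = e x ⊔ e y := by
  let _ := booleanMVStructure B
  have : Nontrivial (AsBoolRing B) := inferInstanceAs (Nontrivial B)
  have : PerfectSpace (PrimeSpectrum (AsBoolRing B)) :=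
    perfectSpace_of_orderIso_clopens (stoneOrderIso B) hB
  obtain ⟨ι', h'⟩ := exists_isLocConstRep_of_orderIso (stoneOrderIso B)
  obtain ⟨e⟩ := h.nonempty_equiv booleanUnit_subset_rationalUnit h'
  exact ⟨e.toEquiv, map_mvZero e, map_mvNeg e, map_mvAdd e⟩

/-- Automorphisms with respect to MV-operations or to the order, along an identification. -/
noncomputable def autMulEquivOrderIso {S : Type*} [mvLang.Structure S] (e : S ≃ B)
    (h0 : e (mvZero S) = ⊥) (hn : ∀ x, e (mvNeg x) = (e x)ᶜ)
    (ha : ∀ x y, e (mvAdd x y) = e x ⊔ e y) : (S ≃[mvLang] S) ≃* (B ≃o B) where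
  toFun τ :=
    { toEquiv := (e.symm.trans τ.toEquiv).trans e
      map_rel_iff' := by
        intro a b
        change e (τ (e.symm a)) ≤ e (τ (e.symm b)) ↔ a ≤ b
        rw [← sup_eq_right, ← ha, ← map_mvAdd, e.injective.eq_iff, τ.injective.eq_iff,
          ← e.injective.eq_iff, ha, e.apply_symm_apply, e.apply_symm_apply, sup_eq_right] }
  invFun g := mvEquiv ((e.trans g.toEquiv).trans e.symm)
    (by
      change e.symm (g (e _)) = _
      rw [h0, map_bot, ← h0, e.symm_apply_apply])
    (by
      intro x
      change e.symm (g (e _)) = mvNeg (e.symm (g (e x)))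
      rw [e.symm_apply_eq, hn, hn, map_compl, e.apply_symm_apply])
    (by
      intro x y
      change e.symm (g (e _)) = mvAdd (e.symm (g (e x))) (e.symm (g (e y)))
      rw [e.symm_apply_eq, ha, ha, map_sup, e.apply_symm_apply, e.apply_symm_apply])
  left_inv τ := FirstOrder.Language.Equiv.ext fun x => by
    change e.symm (e (τ (e.symm (e x)))) = τ x
    simp
  right_inv g := by
    ext x
    change e (e.symm (g (e (e.symm x)))) = g x
    simp
  map_mul' τ ρ := by
    ext x
    change e (τ (ρ (e.symm x))) = e (τ (e.symm (e (ρ (e.symm x)))))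
    rw [e.symm_apply_apply]

end BooleanAlgebras

/-! ### The Cantor set as a perfect Stone space. -/

section CantorSet

instance : CompactSpace cantorSet := isCompact_iff_compactSpace.mp isCompact_cantorSet

theorem totallySeparatedSpace_of_injective {X Y : Type*} [TopologicalSpace X] [TopologicalSpace Y]
    [TotallySeparatedSpace Y] {f : X → Y} (hf : Continuous f) (hinj : Function.Injective f) :
    TotallySeparatedSpace X := by
  rw [totallySeparatedSpace_iff_exists_isClopen]
  intro x y hxy
  obtain ⟨U, hU, hx, hy⟩ := exists_isClopen_of_totally_separated (hinj.ne hxy)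
  exact ⟨f ⁻¹' U, hU.preimage hf, hx, hy⟩

instance : TotallySeparatedSpace (ℕ → Bool) := by
  rw [totallySeparatedSpace_iff_exists_isClopen]
  intro x y hxy
  obtain ⟨n, hn⟩ := Function.ne_iff.1 hxy
  exact ⟨(fun z : ℕ → Bool => z n) ⁻¹' {x n}, (isClopen_discrete _).preimage (continuous_apply n),
    rfl, hn.symm⟩

instance : TotallySeparatedSpace cantorSet :=
  totallySeparatedSpace_of_injective cantorSetHomeomorphNatToBool.continuous
    cantorSetHomeomorphNatToBool.injective

instance : Nonempty cantorSet := ⟨⟨0, zero_mem_cantorSet⟩⟩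

theorem Homeomorph.perfectSpace {X Y : Type*} [TopologicalSpace X] [TopologicalSpace Y]
    [PerfectSpace Y] (e : X ≃ₜ Y) : PerfectSpace X := by
  rw [perfectSpace_iff_forall_not_isolated]
  intro x
  rw [Filter.neBot_iff, Ne, ← isOpen_singleton_iff_punctured_nhds, ← e.isOpen_image,
    Set.image_singleton, isOpen_singleton_iff_punctured_nhds]
  exact (PerfectSpace.not_isolated (e x)).ne

instance : PerfectSpace (ℕ → Bool) := by
  rw [perfectSpace_iff_forall_not_isolated]
  intro x
  rw [Filter.neBot_iff, Ne, ← isOpen_singleton_iff_punctured_nhds]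
  intro hx
  obtain ⟨I, U, hU, hsub⟩ := isOpen_pi_iff.1 hx x rfl
  -- A basic neighbourhood restricts only the coordinates in `I`; flipping another one stays inside
  -- it.
  obtain ⟨n, hn⟩ := Infinite.exists_notMem_finset I
  have h1 : Function.update x n (!x n) ∈ ({x} : Set (ℕ → Bool)) := hsub fun i hi => by
    rw [Function.update_of_ne (by rintro rfl; exact hn hi)]
    exact (hU i hi).2
  have h2 := congrFun h1 n
  rw [Function.update_self] at h2
  exact Bool.not_ne_self _ h2

instance : PerfectSpace cantorSet := cantorSetHomeomorphNatToBool.perfectSpace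

theorem isLocConstRep_cantorMV : IsLocConstRep rationalUnit cantorMV.subtype := by
  intro f
  refine Iff.trans ?_ (mem_rationalFuzzyClopens_iff f)
  exact ⟨fun ⟨s, hs⟩ => hs ▸ s.2, fun hf => ⟨⟨f, hf⟩, rfl⟩⟩

instance : CompactSpace (ULift.{u} cantorSet) := Homeomorph.ulift.symm.compactSpace

instance : TotallySeparatedSpace (ULift.{u} cantorSet) :=
  totallySeparatedSpace_of_injective Homeomorph.ulift.continuous Homeomorph.ulift.injective

instance : PerfectSpace (ULift.{u} cantorSet) := Homeomorph.ulift.perfectSpace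

/-- The rational fuzzy clopens, as functions on a lift of the Cantor set. -/
def liftCantorMV : cantorMV ↪[mvLang] (ULift.{u} cantorSet → unitInterval) :=
  mvEmbedding (fun f x => (f : cantorSet → unitInterval) x.down)
    (fun _ _ h => Subtype.ext (funext fun x => congrFun h ⟨x⟩)) rfl (fun _ => rfl)
    (fun _ _ => rfl)

theorem isLocConstRep_liftCantorMV : IsLocConstRep rationalUnit liftCantorMV.{u} := by
  intro f
  constructor
  · rintro ⟨s, rfl⟩
    exact ⟨(isLocConstRep_cantorMV.isLocallyConstant s).comp_continuous continuous_uliftDown,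
      fun x => isLocConstRep_cantorMV.mem s x.down⟩
  · rintro ⟨hf, hf'⟩
    obtain ⟨s, hs⟩ := (isLocConstRep_cantorMV (fun x => f ⟨x⟩)).2
      ⟨hf.comp_continuous continuous_uliftUp, fun x => hf' _⟩
    exact ⟨s, funext fun x => congrFun hs x.down⟩

end CantorSet

theorem IsLocConstRep.comp_equiv {X S T : Type*} [TopologicalSpace X] [mvLang.Structure S]
    [mvLang.Structure T] {V : Set unitInterval} {ι : S ↪[mvLang] (X → unitInterval)}
    (h : IsLocConstRep V ι) (e : T ≃[mvLang] S) : IsLocConstRep V (ι.comp e.toEmbedding) := by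
  intro f
  rw [← h f]
  constructor
  · rintro ⟨t, rfl⟩
    exact ⟨e t, rfl⟩
  · rintro ⟨s, rfl⟩
    exact ⟨e.symm s, congrArg ι (e.apply_symm_apply s)⟩

/-- Every Fraïssé limit of the finite MV-algebras consists of the locally constant rational-valued
functions on a lift of the Cantor set. -/
theorem exists_isLocConstRep_of_isFraisseLimit {M : Type u} [mvLang.Structure M] [Countable M]
    (h : IsFraisseLimit finiteMV.{u} M) :
    ∃ ι : M ↪[mvLang] (ULift.{u} cantorSet → unitInterval), IsLocConstRep rationalUnit ι := by
  -- The range of the lift lives in the universe of `M`, where uniqueness of Fraïssé limits applies.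
  have hrep := isLocConstRep_liftCantorMV.{u}.comp_equiv liftCantorMV.equivRange.symm
  have : Countable liftCantorMV.{u}.toHom.range := liftCantorMV.equivRange.symm.injective.countable
  obtain ⟨e⟩ := h.nonempty_equiv (isFraisseLimit_of_isLocConstRep hrep)
  exact ⟨_, hrep.comp_equiv e⟩

theorem corollary4p10 :
    IsFraisseLimit finiteMV.{0} cantorMV ∧
    (∃ Φ : (cantorSet ≃ₜ cantorSet) ≃* (cantorMV ≃[mvLang] cantorMV),
      ∀ (h : cantorSet ≃ₜ cantorSet) (f : cantorMV) (x : cantorSet),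
        (Φ h f : cantorSet → unitInterval) x = (f : cantorSet → unitInterval) (h.symm x)) ∧
    ∀ (M : Type u) [mvLang.Structure M] [Countable M], IsFraisseLimit finiteMV.{u} M →
      (∀ (B : Type v) [BooleanAlgebra B] [Countable B] [Nontrivial B], (∀ b : B, ¬ IsAtom b) →
        Nonempty ((M ≃[mvLang] M) ≃* (B ≃o B))) ∧
      ∃ hM : IsMVAlgebra M,
        (∃ R : (M ≃[mvLang] M) ≃* (booleanCenter hM ≃[mvLang] booleanCenter hM),
          ∀ (σ : M ≃[mvLang] M) (b : booleanCenter hM), (R σ b : M) = σ b) ∧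
        ∀ (B : Type v) [BooleanAlgebra B] [Countable B] [Nontrivial B], (∀ b : B, ¬ IsAtom b) →
          ∃ e : booleanCenter hM ≃ B, e (mvZero (booleanCenter hM)) = ⊥ ∧
            (∀ x, e (mvNeg x) = (e x)ᶜ) ∧ ∀ x y, e (mvAdd x y) = e x ⊔ e y := by
  refine ⟨isFraisseLimit_of_isLocConstRep isLocConstRep_cantorMV,
    ⟨isLocConstRep_cantorMV.homeomorphMulEquiv booleanUnit_subset_rationalUnit,
      isLocConstRep_cantorMV.homeomorphMulEquiv_apply booleanUnit_subset_rationalUnit⟩, ?_⟩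
  intro M _ _ hlim
  obtain ⟨ι, h⟩ := exists_isLocConstRep_of_isFraisseLimit hlim
  have hM : IsMVAlgebra M := (fuzzy_isMVAlgebra _).of_injective ι ι.injective
  have hc := h.booleanCenter booleanUnit_subset_rationalUnit hM
  -- Both groups are the homeomorphism group of one space, acting on functions by the same formula,
  -- so passing through it is restriction.
  let R := (h.homeomorphMulEquiv booleanUnit_subset_rationalUnit).symm.trans
    (hc.homeomorphMulEquiv subset_rfl)
  refine ⟨fun B _ _ _ hB => ?_, hM, ⟨R, fun σ b => ι.injective (funext fun x => ?_)⟩,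
    fun B _ _ _ hB => hc.exists_equiv_booleanAlgebra hB⟩
  · obtain ⟨e, h0, hn, ha⟩ := hc.exists_equiv_booleanAlgebra hB
    exact ⟨R.trans (autMulEquivOrderIso e h0 hn ha)⟩
  · obtain ⟨k, rfl⟩ := (h.homeomorphMulEquiv booleanUnit_subset_rationalUnit).surjective σ
    rw [h.homeomorphMulEquiv_apply]
    simp only [R, MulEquiv.trans_apply, MulEquiv.symm_apply_apply]
    exact hc.homeomorphMulEquiv_apply subset_rfl k b x
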